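/- Let $d\ge 3$. For $x,y\in\mathbb{Z}^d$ let $g(x,y)=\sum_{n\ge 0}P_x[X_n=y]$ be the Green function of (discrete-time) simple random walk on $\mathbb{Z}^d$, and let $\mathbb{P}$ be the law on $\mathbb{R}^{\mathbb{Z}^d}$ of the Gaussian free field, i.e. under $\mathbb{P}$ the canonical field $\varphi=(\varphi_x)_{x\in\mathbb{Z}^d}$ is a centered Gaussian field with covariance $\mathbb{E}[\varphi_x\varphi_y]=g(x,y)$. For $h\in\mathbb{R}$ and $K,K'\subset\mathbb{Z}^d$ let $\{K\stackrel{\ge h}{\longleftrightarrow}K'\}$ be the event that some vertex of $K$ and some vertex of $K'$ are joined by a nearest-neighbor path (possibly of length $0$) all of whose vertices lie in the excursion set $\{x\in\mathbb{Z}^d:\varphi_x\ge h\}$; for single points we write $0\stackrel{\ge h}{\longleftrightarrow}x$ instead of $\{0\}\stackrel{\ge h}{\longleftrightarrow}\{x\}$. Let $|\cdot|$ and $|\cdot|_\infty$ denote the Euclidean and the $\ell^\infty$-norm, and put $B(0,r)=\{y\in\mathbb{Z}^d:|y|_\infty\le r\}$ and $S(0,r)=\{y\in\mathbb{Z}^d:|y|_\infty=r\}$.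 With $L$ ranging over the positive integers, define $$h_{**}(d)=\inf\Big\{h\in\mathbb{R}:\ \text{for some }\alpha>0,\ \lim_{L\to\infty}L^{\alpha}\,\mathbb{P}\big[B(0,L)\stackrel{\ge h}{\longleftrightarrow}S(0,2L)\big]=0\Big\}\in[-\infty,\infty],\qquad \inf\emptyset=\infty.$$ Then $h_{**}(d)<\infty$. Moreover, for every real $h>h_{**}(d)$ there exist constants $c,c'>0$ and $\rho\in(0,1)$, depending only on $d$ and $h$, such that $$\mathbb{P}\big[B(0,L)\stackrel{\ge h}{\longleftrightarrow}S(0,2L)\big]\le c\,e^{-c'L^{\rho}}\qquad\text{for all integers }L\ge 1.$$ In particular, the connectivity function has stretched exponential decay: with the same $c$ and $\rho$, there exists $c''>0$, depending only on $d$ and $h$, such that $$\mathbb{P}\big[0\stackrel{\ge h}{\longleftrightarrow}x\big]\le c\,e^{-c''|x|^{\rho}}\qquad\text{for all }x\in\mathbb{Z}^d.$$ -/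

import Mathlib

open MeasureTheory ProbabilityTheory Filter Topology

noncomputable section

namespace GFF

/-- The nearest-neighbor graph on `ℤ^d`: `x` and `y` are adjacent iff their Euclidean distance
is `1`. -/
def latticeGraph (d : ℕ) : SimpleGraph (Fin d → ℤ) where
  Adj x y := ∑ i, (x i - y i) ^ 2 = 1
  symm := ⟨fun x y h => by
    rw [← h]
    exact Finset.sum_congr rfl fun i _ => by ring⟩
  loopless := ⟨fun x h => by simp at h⟩

/-- The Euclidean norm of a lattice point. -/
def euclNorm {d : ℕ} (x : Fin d → ℤ) : ℝ := √(∑ i, (x i : ℝ) ^ 2)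

/-- The `2 d` possible increments `± e_i` of a nearest-neighbor walk on `ℤ^d`. -/
def unitStep {d : ℕ} (s : Fin d × Bool) : Fin d → ℤ :=
  Pi.single s.1 (if s.2 then 1 else -1)

/-- `P_x[X_n = y]` for simple random walk on `ℤ^d`: under `P_x`, `X_n` is `x` plus the sum of `n`
independent increments that are uniform on the `2 d` unit steps. -/
def walkProb {d : ℕ} (n : ℕ) (x y : Fin d → ℤ) : ℝ :=
  (Fintype.card {s : Fin n → Fin d × Bool // x + ∑ k, unitStep (s k) = y} : ℝ) / (2 * d : ℝ) ^ n

/-- The Green function `g(x, y) = ∑_{n ≥ 0} P_x[X_n = y]` of simple random walk. -/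
def green {d : ℕ} (x y : Fin d → ℤ) : ℝ := ∑' n : ℕ, walkProb n x y

/-- `P` is the law on `ℝ^{ℤ^d}` of the Gaussian free field: under `P` the canonical field is a
centered Gaussian field with covariance the Green function. -/
structure IsGaussianFreeField (d : ℕ) (P : Measure ((Fin d → ℤ) → ℝ)) : Prop where
  gaussian : IsGaussianProcess (fun (x : Fin d → ℤ) (φ : (Fin d → ℤ) → ℝ) => φ x) P
  centered : ∀ x : Fin d → ℤ, ∫ φ, φ x ∂P = 0
  covariance : ∀ x y : Fin d → ℤ, ∫ φ, φ x * φ y ∂P = green x y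

/-- The event that `K` and `K'` are connected by a nearest-neighbor path (possibly of length `0`)
in the excursion set `{x | h ≤ φ x}`. -/
def connects {d : ℕ} (h : ℝ) (K K' : Set (Fin d → ℤ)) : Set ((Fin d → ℤ) → ℝ) :=
  {φ | ∃ x ∈ K, ∃ y ∈ K', ∃ w : (latticeGraph d).Walk x y, ∀ z ∈ w.support, h ≤ φ z}

/-- The probability that the ball `B(0, L)` is connected to the sphere `S(0, 2 L)` above level `h`;
the metric on `Fin d → ℤ` is the `ℓ^∞` metric. -/
def crossProb {d : ℕ} (P : Measure ((Fin d → ℤ) → ℝ)) (h : ℝ) (L : ℕ) : ℝ :=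
  P.real (connects h (Metric.closedBall 0 (L : ℝ)) (Metric.sphere 0 (2 * L : ℝ)))

/-- The critical level `h_**`, in `[-∞, ∞]` (with `inf ∅ = ∞`). -/
def hStarStar {d : ℕ} (P : Measure ((Fin d → ℤ) → ℝ)) : EReal :=
  sInf ((fun h : ℝ => (h : EReal)) ''
    {h : ℝ | ∃ α : ℝ, 0 < α ∧
      Tendsto (fun L : ℕ => (L : ℝ) ^ α * crossProb P h L) atTop (𝓝 0)})

end GFF

end

/-! The proof is a multi-scale renormalization with sprinkling. A crossing at scale `L'` forces two
crossings at a smaller scale `L` in well separated boxes. If these were independent, crossing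
probabilities would obey `q' ≤ A q²`, with `A` counting pairs of boxes, and a small value at one
scale would improve to `exp (-2 ^ n)` along a geometric sequence of scales, that is, to a stretched
exponential in `L`.

The field has long-range correlations, so independence is bought by lowering the level
(`measureReal_inter_levelEvent_le`). The field in one box is its linear regression on the other box
plus an independent residual, and the regression is at most `δ / 2` throughout the box up to a
Gaussian tail error. Its variance is small because cutting the Green function after `2 N` steps
splits it into two positive semidefinite kernels, the first of which vanishes at distance `2 N` and
beyond: distant values can explain only the tail of the Green function (`regression_variance_le`). A
Fourier bound on the heat kernel makes this tail at most `C N ^ (-1/4)`.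

`exists_scale_decay` runs the recursion with summable level decrements. It needs one small crossing
probability at a large scale, with thresholds that do not depend on the level. Gaussian tails
provide it at a high level, so `h_**` is finite; the definition of `h_**` provides it below any `h >
h_**`, and the gap between the two levels pays for the sprinkling. -/

noncomputable section

namespace GFF

/-! ### Fourier representation of the simple random walk -/

/-- The uniform probability measure on `(-π, π]`. -/
def circleMeasure : Measure ℝ :=
  (ENNReal.ofReal (2 * Real.pi))⁻¹ • volume.restrict (Set.Ioc (-Real.pi) Real.pi)

instance : IsProbabilityMeasure circleMeasure := by
  constructor
  have h : (ENNReal.ofReal (2 * Real.pi)) ≠ 0 := by simp [Real.pi_pos]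
  simp only [circleMeasure, Measure.smul_apply, Measure.restrict_apply MeasurableSet.univ,
    Set.univ_inter, Real.volume_Ioc, smul_eq_mul]
  rw [show Real.pi - -Real.pi = 2 * Real.pi by ring]
  exact ENNReal.inv_mul_cancel h ENNReal.ofReal_ne_top

lemma integral_circleMeasure {E : Type*} [NormedAddCommGroup E] [NormedSpace ℝ E] (f : ℝ → E) :
    ∫ t, f t ∂circleMeasure = (2 * Real.pi)⁻¹ • ∫ t in (-Real.pi)..Real.pi, f t := by
  rw [circleMeasure, integral_smul_measure,
    intervalIntegral.integral_of_le (by linarith [Real.pi_pos]), ENNReal.toReal_inv,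
    ENNReal.toReal_ofReal (by positivity)]

/-- The uniform probability measure on `(-π, π]^d`. -/
def torusMeasure (d : ℕ) : Measure (Fin d → ℝ) := Measure.pi fun _ => circleMeasure

instance (d : ℕ) : IsProbabilityMeasure (torusMeasure d) := by
  unfold torusMeasure; infer_instance

lemma integral_circleMeasure_exp (m : ℤ) :
    ∫ t, Complex.exp (Complex.I * (t * m)) ∂circleMeasure = if m = 0 then 1 else 0 := by
  rw [integral_circleMeasure]
  have hpi : (Real.pi : ℂ) ≠ 0 := by exact_mod_cast Real.pi_ne_zero
  split_ifs with h
  · subst h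
    simp only [Int.cast_zero, mul_zero, Complex.exp_zero, intervalIntegral.integral_const]
    rw [Complex.real_smul, Complex.real_smul]
    push_cast
    field_simp
    ring
  · have hc : Complex.I * (m : ℂ) ≠ 0 := mul_ne_zero Complex.I_ne_zero (by exact_mod_cast h)
    have : (fun t : ℝ => Complex.exp (Complex.I * (t * m))) =
        fun t : ℝ => Complex.exp ((Complex.I * m) * t) := by
      ext t; congr 1; ring
    rw [this, integral_exp_mul_complex hc]
    have e : Complex.exp (Complex.I * m * (Real.pi : ℝ)) =
        Complex.exp (Complex.I * m * ((-Real.pi : ℝ) : ℂ)) := by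
      rw [Complex.exp_eq_exp_iff_exists_int]
      exact ⟨m, by push_cast; ring⟩
    rw [e]; simp

/-- The character `θ ↦ exp (i θ · z)` of the torus. -/
def torusChar {d : ℕ} (z : Fin d → ℤ) (θ : Fin d → ℝ) : ℂ :=
  Complex.exp (Complex.I * ∑ i, (θ i * z i : ℂ))

lemma continuous_torusChar {d : ℕ} (z : Fin d → ℤ) : Continuous (torusChar z) := by
  unfold torusChar; fun_prop

lemma torusChar_add {d : ℕ} (z w : Fin d → ℤ) (θ : Fin d → ℝ) :
    torusChar (z + w) θ = torusChar z θ * torusChar w θ := by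
  simp only [torusChar, ← Complex.exp_add]
  congr 1
  rw [← mul_add, ← Finset.sum_add_distrib]
  congr 1
  exact Finset.sum_congr rfl fun i _ => by push_cast [Pi.add_apply]; ring

lemma torusChar_zero {d : ℕ} (θ : Fin d → ℝ) : torusChar 0 θ = 1 := by
  simp [torusChar]

lemma torusChar_sum {d : ℕ} {ι : Type*} (s : Finset ι) (z : ι → Fin d → ℤ) (θ : Fin d → ℝ) :
    torusChar (∑ k ∈ s, z k) θ = ∏ k ∈ s, torusChar (z k) θ := by
  classical
  induction s using Finset.induction_on with
  | empty => simp [torusChar_zero]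
  | insert a s ha ih => rw [Finset.sum_insert ha, Finset.prod_insert ha, torusChar_add, ih]

lemma norm_torusChar {d : ℕ} (z : Fin d → ℤ) (θ : Fin d → ℝ) : ‖torusChar z θ‖ = 1 := by
  rw [torusChar, show Complex.I * ∑ i, (θ i * z i : ℂ) = ((∑ i, θ i * z i : ℝ) : ℂ) * Complex.I by
    push_cast; ring]
  exact Complex.norm_exp_ofReal_mul_I _

lemma torusChar_neg {d : ℕ} (z : Fin d → ℤ) (θ : Fin d → ℝ) :
    torusChar (-z) θ = (starRingEnd ℂ) (torusChar z θ) := by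
  rw [torusChar, torusChar, ← Complex.exp_conj]
  congr 1
  simp only [map_mul, Complex.conj_I, map_sum, Complex.conj_ofReal, map_intCast, Pi.neg_apply,
    Int.cast_neg, mul_neg, Finset.sum_neg_distrib, neg_mul]

lemma integral_torusChar {d : ℕ} (z : Fin d → ℤ) :
    ∫ θ, torusChar z θ ∂torusMeasure d = if z = 0 then 1 else 0 := by
  have h : ∀ θ : Fin d → ℝ, torusChar z θ = ∏ i, Complex.exp (Complex.I * (θ i * z i)) := by
    intro θ
    rw [torusChar, ← Complex.exp_sum, Finset.mul_sum]
  simp_rw [h]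
  rw [torusMeasure, integral_fintype_prod_eq_prod
    (fun i (t : ℝ) => Complex.exp (Complex.I * (t * z i)))]
  simp_rw [integral_circleMeasure_exp]
  split_ifs with hz
  · simp [hz]
  · obtain ⟨i, hi⟩ := Function.ne_iff.1 hz
    exact Finset.prod_eq_zero (Finset.mem_univ i) (if_neg hi)

/-- The symbol `(1 / d) ∑ cos θ_i` of the transition operator of simple random walk. -/
def stepSymbol {d : ℕ} (θ : Fin d → ℝ) : ℝ := (∑ i, Real.cos (θ i)) / d

lemma continuous_stepSymbol {d : ℕ} : Continuous (stepSymbol (d := d)) := by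
  unfold stepSymbol; fun_prop

lemma sum_torusChar_unitStep {d : ℕ} (hd : 0 < d) (θ : Fin d → ℝ) :
    ∑ s : Fin d × Bool, torusChar (unitStep s) θ = (2 * d : ℝ) * stepSymbol θ := by
  have key : ∀ i : Fin d, ∀ e : ℤ,
      torusChar (Pi.single i e) θ = Complex.exp (Complex.I * (θ i * e)) := by
    intro i e
    rw [torusChar]
    congr 2
    rw [Finset.sum_eq_single i] <;> simp +contextual
  have hd' : (d : ℂ) ≠ 0 := by exact_mod_cast hd.ne'
  rw [Fintype.sum_prod_type]
  simp only [Fintype.sum_bool, unitStep, key, if_true]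
  simp only [stepSymbol, Complex.ofReal_mul, Complex.ofReal_div, Complex.ofReal_sum,
    Complex.ofReal_cos]
  push_cast
  rw [mul_div_assoc', eq_div_iff hd', Finset.sum_mul, Finset.mul_sum]
  refine Finset.sum_congr rfl fun i _ => ?_
  rw [Complex.cos]
  simp only [mul_one, mul_neg, neg_mul]
  rw [mul_comm Complex.I]
  ring

/-- The power of the symbol is the average of characters over all step sequences; orthogonality
keeps exactly those leading from `x` to `y`. -/
lemma walkProb_eq_integral {d : ℕ} (hd : 0 < d) (n : ℕ) (x y : Fin d → ℤ) :
    (walkProb n x y : ℂ) =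
      ∫ θ, ((stepSymbol θ ^ n : ℝ) : ℂ) * torusChar (x - y) θ ∂torusMeasure d := by
  have hd' : (2 * d : ℂ) ≠ 0 := by
    simpa using hd.ne'
  have hpt : ∀ θ : Fin d → ℝ, ((stepSymbol θ ^ n : ℝ) : ℂ) * torusChar (x - y) θ =
      ((2 * d : ℂ) ^ n)⁻¹ * ∑ s : Fin n → Fin d × Bool,
        torusChar (x - y + ∑ k, unitStep (s k)) θ := by
    intro θ
    have h1 := sum_torusChar_unitStep hd θ
    have h2 : ∑ s : Fin n → Fin d × Bool, torusChar (x - y + ∑ k, unitStep (s k)) θ =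
        torusChar (x - y) θ * ((2 * d : ℝ) * stepSymbol θ : ℂ) ^ n := by
      simp_rw [torusChar_add, torusChar_sum]
      rw [← Finset.mul_sum, ← h1, Fintype.sum_pow]
    rw [h2]
    push_cast
    generalize (2 * d : ℂ) = D at hd'
    rw [mul_pow]
    field_simp
  simp_rw [hpt]
  rw [integral_const_mul, integral_finsetSum]
  · simp_rw [integral_torusChar]
    rw [walkProb, Fintype.card_subtype, Finset.sum_boole]
    push_cast
    rw [div_eq_inv_mul]
    congr 3
    ext s
    simp only [Finset.mem_filter, Finset.mem_univ, true_and]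
    rw [sub_add_eq_add_sub, sub_eq_zero]
  · intro s _
    refine Integrable.of_bound (C := 1) (continuous_torusChar _).aestronglyMeasurable ?_
    exact ae_of_all _ fun θ => (norm_torusChar _ θ).le

lemma abs_stepSymbol_le_one {d : ℕ} (θ : Fin d → ℝ) : |stepSymbol θ| ≤ 1 := by
  rw [stepSymbol, abs_div, Nat.abs_cast]
  refine div_le_one_of_le₀ ?_ (Nat.cast_nonneg d)
  calc |∑ i, Real.cos (θ i)| ≤ ∑ i, |Real.cos (θ i)| := Finset.abs_sum_le_sum_abs _ _
    _ ≤ ∑ _i : Fin d, (1 : ℝ) := Finset.sum_le_sum fun i _ => Real.abs_cos_le_one _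
    _ = d := by simp

lemma integrable_of_continuous_of_bounded {d : ℕ} {E : Type*} [NormedAddCommGroup E]
    [SecondCountableTopology E] {f : (Fin d → ℝ) → E}
    (hf : Continuous f) (C : ℝ) (hC : ∀ θ, ‖f θ‖ ≤ C) : Integrable f (torusMeasure d) :=
  Integrable.of_bound hf.aestronglyMeasurable C (ae_of_all _ hC)

lemma abs_stepSymbol_pow_le_one {d : ℕ} (n : ℕ) (θ : Fin d → ℝ) : |stepSymbol θ ^ n| ≤ 1 := by
  rw [abs_pow]; exact pow_le_one₀ (abs_nonneg _) (abs_stepSymbol_le_one θ)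

/-- The quadratic form of the `n`-step transition kernel in Fourier space. -/
lemma sum_sum_walkProb_eq_integral {d : ℕ} (hd : 0 < d) (n : ℕ) (K : Finset (Fin d → ℤ))
    (a : (Fin d → ℤ) → ℝ) :
    ∑ x ∈ K, ∑ y ∈ K, a x * a y * walkProb n x y =
      ∫ θ, stepSymbol θ ^ n * ‖∑ x ∈ K, a x * torusChar x θ‖ ^ 2 ∂torusMeasure d := by
  rw [← Complex.ofReal_inj, ← integral_complex_ofReal]
  have hpt : ∀ θ : Fin d → ℝ,
      ((stepSymbol θ ^ n * ‖∑ x ∈ K, a x * torusChar x θ‖ ^ 2 : ℝ) : ℂ) =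
      ∑ x ∈ K, ∑ y ∈ K,
        (a x * a y : ℂ) * (((stepSymbol θ ^ n : ℝ) : ℂ) * torusChar (x - y) θ) := by
    intro θ
    rw [Complex.ofReal_mul]
    push_cast
    rw [← Complex.mul_conj', map_sum, Finset.sum_mul_sum, Finset.mul_sum]
    refine Finset.sum_congr rfl fun x _ => ?_
    rw [Finset.mul_sum]
    refine Finset.sum_congr rfl fun y _ => ?_
    rw [map_mul, Complex.conj_ofReal, sub_eq_add_neg, torusChar_add, torusChar_neg]
    ring
  simp_rw [hpt]
  have hint : ∀ x y : Fin d → ℤ, Integrable (fun θ : Fin d → ℝ =>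
      (a x * a y : ℂ) * (((stepSymbol θ ^ n : ℝ) : ℂ) * torusChar (x - y) θ))
      (torusMeasure d) := by
    intro x y
    refine Integrable.const_mul ?_ _
    refine integrable_of_continuous_of_bounded ?_ 1 fun θ => ?_
    · have h1 := continuous_torusChar (x - y)
      have h2 := continuous_stepSymbol (d := d)
      fun_prop
    · rw [norm_mul, norm_torusChar, mul_one, Complex.norm_real]
      exact abs_stepSymbol_pow_le_one n θ
  rw [integral_finsetSum _ fun x _ => integrable_finsetSum _ fun y _ => hint x y]
  rw [Complex.ofReal_sum]
  refine Finset.sum_congr rfl fun x _ => ?_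
  rw [Complex.ofReal_sum, integral_finsetSum _ fun y _ => hint x y]
  refine Finset.sum_congr rfl fun y _ => ?_
  rw [integral_const_mul, ← walkProb_eq_integral hd]
  push_cast
  rfl

lemma continuous_norm_sq_sum_torusChar {d : ℕ} (K : Finset (Fin d → ℤ)) (a : (Fin d → ℤ) → ℝ) :
    Continuous fun θ : Fin d → ℝ => ‖∑ x ∈ K, (a x : ℂ) * torusChar x θ‖ ^ 2 := by
  have h := fun x : Fin d → ℤ => continuous_torusChar x
  fun_prop

lemma norm_sq_sum_torusChar_le {d : ℕ} (K : Finset (Fin d → ℤ)) (a : (Fin d → ℤ) → ℝ)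
    (θ : Fin d → ℝ) : ‖∑ x ∈ K, (a x : ℂ) * torusChar x θ‖ ^ 2 ≤ (∑ x ∈ K, |a x|) ^ 2 := by
  gcongr
  refine (norm_sum_le _ _).trans (Finset.sum_le_sum fun x _ => ?_)
  rw [norm_mul, norm_torusChar, mul_one, Complex.norm_real, Real.norm_eq_abs]

/-- Two consecutive transition kernels, starting with an even one, add up to a positive
semidefinite kernel. -/
lemma sum_sum_walkProb_even_add_odd_nonneg {d : ℕ} (hd : 0 < d) (k : ℕ) (K : Finset (Fin d → ℤ))
    (a : (Fin d → ℤ) → ℝ) :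
    0 ≤ ∑ x ∈ K, ∑ y ∈ K, a x * a y * walkProb (2 * k) x y +
      ∑ x ∈ K, ∑ y ∈ K, a x * a y * walkProb (2 * k + 1) x y := by
  rw [sum_sum_walkProb_eq_integral hd, sum_sum_walkProb_eq_integral hd, ← integral_add]
  · refine integral_nonneg fun θ => ?_
    have h1 := abs_le.1 (abs_stepSymbol_le_one θ)
    rw [pow_succ (stepSymbol θ), pow_mul]
    have : 0 ≤ (stepSymbol θ ^ 2) ^ k * (1 + stepSymbol θ) *
        ‖∑ x ∈ K, (a x : ℂ) * torusChar x θ‖ ^ 2 := by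
      have : 0 ≤ 1 + stepSymbol θ := by linarith
      positivity
    simp only [Pi.zero_apply]
    linarith
  all_goals
    refine integrable_of_continuous_of_bounded
      ((continuous_stepSymbol.pow _).mul (continuous_norm_sq_sum_torusChar K a))
      (1 * (∑ x ∈ K, |a x|) ^ 2) fun θ => ?_
    rw [norm_mul, Real.norm_eq_abs, Real.norm_of_nonneg (by positivity)]
    exact mul_le_mul (abs_stepSymbol_pow_le_one _ θ) (norm_sq_sum_torusChar_le K a θ)
      (by positivity) zero_le_one

/-! ### Heat kernel bound and transience -/

lemma walkProb_nonneg {d : ℕ} (n : ℕ) (x y : Fin d → ℤ) : 0 ≤ walkProb n x y := by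
  unfold walkProb; positivity

/-- Cauchy-Schwarz followed by `1 + t ≤ exp t`. The product form reduces the torus integral to a
power of a one-dimensional one. -/
lemma stepSymbol_sq_le {d : ℕ} (hd : 0 < d) (θ : Fin d → ℝ) :
    stepSymbol θ ^ 2 ≤ ∏ i, Real.exp (-(Real.sin (θ i) ^ 2 / d)) := by
  have hd' : (0 : ℝ) < d := by exact_mod_cast hd
  have h1 : (∑ i, Real.cos (θ i)) ^ 2 ≤ d * ∑ i, Real.cos (θ i) ^ 2 := by
    simpa using sq_sum_le_card_mul_sum_sq (s := Finset.univ) (f := fun i => Real.cos (θ i))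
  have h2 : ∑ i, Real.cos (θ i) ^ 2 = d - ∑ i, Real.sin (θ i) ^ 2 := by
    simp_rw [Real.cos_sq', Finset.sum_sub_distrib]
    simp
  rw [← Real.exp_sum, Finset.sum_neg_distrib, ← Finset.sum_div]
  have h3 := Real.add_one_le_exp (-((∑ i, Real.sin (θ i) ^ 2) / d))
  refine le_trans ?_ h3
  rw [stepSymbol, div_pow, div_le_iff₀ (by positivity)]
  calc _ ≤ _ := h1
    _ = _ := by rw [h2]; field_simp; ring

lemma mul_sq_le_sin_sq (t : ℝ) (h0 : -(Real.pi / 2) ≤ t) (h1 : t ≤ Real.pi / 2) :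
    (2 / Real.pi * t) ^ 2 ≤ Real.sin t ^ 2 := by
  rcases le_total 0 t with h | h
  · have := Real.mul_le_sin h h1
    have h2 : 0 ≤ 2 / Real.pi * t := by positivity
    gcongr
  · have := Real.mul_le_sin (x := -t) (by linarith) (by linarith)
    rw [Real.sin_neg] at this
    have h2 : 0 ≤ 2 / Real.pi * -t := mul_nonneg (by positivity) (by linarith)
    nlinarith

/-- On `[-π, π]` the sine vanishes at `0` and `±π`, and one of these zeros lies within `π / 2` of
`t`, where Jordan's inequality applies. The zeros `±π` reflect the parity of the walk. -/
lemma exp_neg_mul_sin_sq_le (b t : ℝ) (hb : 0 ≤ b) (h0 : -Real.pi ≤ t) (h1 : t ≤ Real.pi) :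
    Real.exp (-(b * Real.sin t ^ 2)) ≤
      Real.exp (-(b * (2 / Real.pi) ^ 2) * t ^ 2) +
      Real.exp (-(b * (2 / Real.pi) ^ 2) * (t - Real.pi) ^ 2) +
      Real.exp (-(b * (2 / Real.pi) ^ 2) * (t - -Real.pi) ^ 2) := by
  have key : ∀ u : ℝ, -(Real.pi / 2) ≤ u → u ≤ Real.pi / 2 → Real.sin u ^ 2 = Real.sin t ^ 2 →
      Real.exp (-(b * Real.sin t ^ 2)) ≤ Real.exp (-(b * (2 / Real.pi) ^ 2) * u ^ 2) := by
    intro u hu0 hu1 hs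
    rw [Real.exp_le_exp, ← hs]
    have := mul_sq_le_sin_sq u hu0 hu1
    rw [mul_pow] at this
    have := mul_le_mul_of_nonneg_left this hb
    linarith
  have p1 := Real.exp_pos (-(b * (2 / Real.pi) ^ 2) * t ^ 2)
  have p2 := Real.exp_pos (-(b * (2 / Real.pi) ^ 2) * (t - Real.pi) ^ 2)
  have p3 := Real.exp_pos (-(b * (2 / Real.pi) ^ 2) * (t - -Real.pi) ^ 2)
  rcases le_or_gt t (Real.pi / 2) with h | h
  · rcases le_or_gt (-(Real.pi / 2)) t with h' | h'
    · linarith [key t h' h rfl]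
    · linarith [key (t - -Real.pi) (by linarith) (by linarith) (by simp)]
  · linarith [key (t - Real.pi) (by linarith) (by linarith) (by simp)]

lemma integral_exp_neg_mul_sin_sq_le (b : ℝ) (hb : 0 < b) :
    ∫ t, Real.exp (-(b * Real.sin t ^ 2)) ∂circleMeasure ≤ 2 * Real.pi / √b := by
  have hpi := Real.pi_pos
  set c := b * (2 / Real.pi) ^ 2 with hc
  have hcpos : 0 < c := by positivity
  have hg := integrable_exp_neg_mul_sq hcpos
  have hg1 := hg.comp_sub_right Real.pi
  have hg2 := hg.comp_sub_right (-Real.pi)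
  have hle : ∫ t in (-Real.pi)..Real.pi, Real.exp (-(b * Real.sin t ^ 2)) ≤
      3 * √(Real.pi / c) := by
    rw [intervalIntegral.integral_of_le (by linarith)]
    calc ∫ t in Set.Ioc (-Real.pi) Real.pi, Real.exp (-(b * Real.sin t ^ 2))
        ≤ ∫ t in Set.Ioc (-Real.pi) Real.pi, (Real.exp (-c * t ^ 2) +
            Real.exp (-c * (t - Real.pi) ^ 2) + Real.exp (-c * (t - -Real.pi) ^ 2)) := by
          refine setIntegral_mono_on ?_ ((hg.add hg1).add hg2).integrableOn measurableSet_Ioc ?_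
          · exact (Continuous.integrableOn_Icc (by fun_prop)).mono_set Set.Ioc_subset_Icc_self
          · intro t ht
            exact exp_neg_mul_sin_sq_le b t hb.le ht.1.le ht.2
      _ ≤ ∫ t, (Real.exp (-c * t ^ 2) +
            Real.exp (-c * (t - Real.pi) ^ 2) + Real.exp (-c * (t - -Real.pi) ^ 2)) := by
          refine setIntegral_le_integral ((hg.add hg1).add hg2) (ae_of_all _ fun t => ?_)
          simp only [Pi.zero_apply]
          positivity
      _ = 3 * √(Real.pi / c) := by
          have e1 := integral_sub_right_eq_self (μ := volume)
            (fun t : ℝ => Real.exp (-c * t ^ 2)) Real.pi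
          have e2 := integral_sub_right_eq_self (μ := volume)
            (fun t : ℝ => Real.exp (-c * t ^ 2)) (-Real.pi)
          rw [integral_add (f := fun t : ℝ => Real.exp (-c * t ^ 2) +
            Real.exp (-c * (t - Real.pi) ^ 2)) (hg.add hg1) hg2, integral_add hg hg1, e1, e2,
            integral_gaussian]
          ring
  rw [integral_circleMeasure, smul_eq_mul]
  have hsq : √(Real.pi / c) = Real.pi / 2 * √Real.pi / √b := by
    rw [hc, show Real.pi / (b * (2 / Real.pi) ^ 2) = (Real.pi / 2) ^ 2 * Real.pi / b by
      field_simp, Real.sqrt_div (by positivity), Real.sqrt_mul (by positivity),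
      Real.sqrt_sq (by positivity)]
  have hs2 : √Real.pi ≤ 2 := by
    rw [Real.sqrt_le_left (by norm_num)]; linarith [Real.pi_le_four]
  have hsb : 0 < √b := Real.sqrt_pos.2 hb
  calc (2 * Real.pi)⁻¹ * _ ≤ (2 * Real.pi)⁻¹ * (3 * √(Real.pi / c)) := by gcongr
    _ = 3 / 4 * √Real.pi / √b := by rw [hsq]; field_simp; ring
    _ ≤ 2 * Real.pi / √b := by
        refine div_le_div_of_nonneg_right ?_ hsb.le
        linarith [Real.pi_gt_three]

/-- Lowering the exponent `n` to the even number `2 ⌊n / 2⌋` turns the integrand into a power of the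
squared symbol, which is nonnegative and factorizes under the bound above. -/
lemma walkProb_le_prod {d : ℕ} (hd : 0 < d) (n : ℕ) (x y : Fin d → ℤ) :
    walkProb n x y ≤
      (∫ t, Real.exp (-(((n / 2 : ℕ) : ℝ) / d * Real.sin t ^ 2)) ∂circleMeasure) ^ d := by
  set k := n / 2 with hk
  have h1 : walkProb n x y ≤ ∫ θ, stepSymbol θ ^ (2 * k) ∂torusMeasure d := by
    calc walkProb n x y = ‖(walkProb n x y : ℂ)‖ := by
          rw [Complex.norm_real, Real.norm_of_nonneg (walkProb_nonneg n x y)]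
      _ ≤ ∫ θ, ‖((stepSymbol θ ^ n : ℝ) : ℂ) * torusChar (x - y) θ‖ ∂torusMeasure d := by
          rw [walkProb_eq_integral hd]; exact norm_integral_le_integral_norm _
      _ ≤ _ := by
          refine integral_mono_of_nonneg (ae_of_all _ fun θ => norm_nonneg _) ?_
            (ae_of_all _ fun θ => ?_)
          · exact integrable_of_continuous_of_bounded (continuous_stepSymbol.pow _) 1
              fun θ => abs_stepSymbol_pow_le_one _ θ
          · simp only [norm_mul, norm_torusChar, mul_one, Complex.norm_real, Real.norm_eq_abs,
              abs_pow]
            rw [← Even.pow_abs (even_two_mul k)]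
            exact pow_le_pow_of_le_one (abs_nonneg _) (abs_stepSymbol_le_one θ) (by omega)
  refine h1.trans ?_
  have h2 : ∀ θ : Fin d → ℝ, stepSymbol θ ^ (2 * k) ≤
      ∏ i, Real.exp (-((k : ℝ) / d * Real.sin (θ i) ^ 2)) := by
    intro θ
    rw [pow_mul]
    calc (stepSymbol θ ^ 2) ^ k ≤ (∏ i, Real.exp (-(Real.sin (θ i) ^ 2 / d))) ^ k := by
          gcongr; exact stepSymbol_sq_le hd θ
      _ = _ := by
          rw [← Finset.prod_pow]
          refine Finset.prod_congr rfl fun i _ => ?_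
          rw [← Real.exp_nat_mul]
          congr 1; ring
  calc ∫ θ, stepSymbol θ ^ (2 * k) ∂torusMeasure d
      ≤ ∫ θ, ∏ i, Real.exp (-((k : ℝ) / d * Real.sin (θ i) ^ 2)) ∂torusMeasure d := by
        refine integral_mono ?_ ?_ h2
        · exact integrable_of_continuous_of_bounded (continuous_stepSymbol.pow _) 1
              fun θ => abs_stepSymbol_pow_le_one _ θ
        · refine integrable_of_continuous_of_bounded (by fun_prop) 1 fun θ => ?_
          rw [Real.norm_of_nonneg (by positivity)]
          refine Finset.prod_le_one (fun i _ => by positivity) fun i _ => ?_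
          rw [Real.exp_le_one_iff, neg_nonpos]
          positivity
    _ = _ := by
        rw [torusMeasure, integral_fintype_prod_eq_prod
          (fun i (t : ℝ) => Real.exp (-((k : ℝ) / d * Real.sin t ^ 2)))]
        simp

lemma exists_walkProb_le {d : ℕ} (hd : 3 ≤ d) :
    ∃ C : ℝ, 0 < C ∧ ∀ (n : ℕ) (x y : Fin d → ℤ),
      walkProb n x y ≤ C * ((n : ℝ) + 1) ^ (-(3 / 2) : ℝ) := by
  have hd0 : (0 : ℝ) < d := by exact_mod_cast (by omega : 0 < d)
  -- The summand `2` covers `n ≤ 1`; the other covers `n ≥ 2`, where `⌊n / 2⌋ ≥ (n + 1) / 4`.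
  set A := 2 + 4 * Real.pi * √d with hA
  have hA0 : 0 < A := by positivity
  refine ⟨A ^ 3, by positivity, fun n x y => ?_⟩
  set I := ∫ t, Real.exp (-(((n / 2 : ℕ) : ℝ) / d * Real.sin t ^ 2)) ∂circleMeasure with hI
  have hI0 : 0 ≤ I := integral_nonneg fun t => (Real.exp_pos _).le
  have hI1 : I ≤ 1 := by
    calc I ≤ ∫ _t, (1 : ℝ) ∂circleMeasure := by
          refine integral_mono_of_nonneg (ae_of_all _ fun t => (Real.exp_pos _).le)
            (integrable_const _) (ae_of_all _ fun t => ?_)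
          simp only [Real.exp_le_one_iff, neg_nonpos]
          positivity
      _ = 1 := by simp
  have hs : 0 < √((n : ℝ) + 1) := Real.sqrt_pos.2 (by positivity)
  have hIn : I ≤ A / √((n : ℝ) + 1) := by
    rcases Nat.lt_or_ge n 2 with h | h
    · refine hI1.trans ?_
      rw [le_div_iff₀ hs, one_mul]
      have : √((n : ℝ) + 1) ≤ 2 := by
        rw [Real.sqrt_le_left (by norm_num)]
        have : (n : ℝ) ≤ 1 := by exact_mod_cast (by omega : n ≤ 1)
        linarith
      have : 0 ≤ 4 * Real.pi * √d := by positivity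
      linarith
    · have hk : (((n : ℝ) + 1) / 4) ≤ ((n / 2 : ℕ) : ℝ) := by
        have : n + 1 ≤ 4 * (n / 2) := by omega
        have : ((n + 1 : ℕ) : ℝ) ≤ ((4 * (n / 2) : ℕ) : ℝ) := by exact_mod_cast this
        push_cast at this ⊢
        linarith
      have hkpos : (0 : ℝ) < ((n / 2 : ℕ) : ℝ) := lt_of_lt_of_le (by positivity) hk
      refine (integral_exp_neg_mul_sin_sq_le _ (by positivity)).trans ?_
      calc 2 * Real.pi / √(((n / 2 : ℕ) : ℝ) / d)
          ≤ 2 * Real.pi / √((((n : ℝ) + 1) / 4) / d) := by gcongr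
        _ = 4 * Real.pi * √d / √((n : ℝ) + 1) := by
            rw [Real.sqrt_div (by positivity), Real.sqrt_div (by positivity),
              show (4 : ℝ) = 2 ^ 2 by norm_num, Real.sqrt_sq (by norm_num)]
            field_simp
        _ ≤ A / √((n : ℝ) + 1) := by gcongr; linarith
  calc walkProb n x y ≤ I ^ d := walkProb_le_prod (by omega) n x y
    -- Since `I ≤ 1`, the three-dimensional rate serves every `d ≥ 3`.
    _ ≤ I ^ 3 := pow_le_pow_of_le_one hI0 hI1 hd
    _ ≤ (A / √((n : ℝ) + 1)) ^ 3 := by gcongr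
    _ = A ^ 3 * ((n : ℝ) + 1) ^ (-(3 / 2) : ℝ) := by
        rw [div_pow, Real.sqrt_eq_rpow, ← Real.rpow_natCast (_ ^ _), ← Real.rpow_mul (by positivity),
          Real.rpow_neg (by positivity), div_eq_mul_inv]
        norm_num

lemma summable_walkProb {d : ℕ} (hd : 3 ≤ d) (x y : Fin d → ℤ) :
    Summable fun n => walkProb n x y := by
  obtain ⟨C, -, hC⟩ := exists_walkProb_le hd
  refine Summable.of_nonneg_of_le (fun n => walkProb_nonneg n x y) (fun n => hC n x y) ?_
  refine Summable.mul_left _ ?_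
  have := (summable_nat_add_iff 1).2 (Real.summable_nat_rpow.2 (by norm_num : (-(3 / 2) : ℝ) < -1))
  simpa using this

/-! ### Finite-range truncation of the Green function -/

/-- The part of the Green function that comes from the first `2 N` steps of the walk. -/
def greenLow {d : ℕ} (N : ℕ) (x y : Fin d → ℤ) : ℝ := ∑ n ∈ Finset.range (2 * N), walkProb n x y

/-- Split the exponent as `3/2 = 1/4 + 5/4`: the second part keeps the series summable, the first
gives the decay in `N`. The rate is not sharp, but some positive power is all the renormalization
needs. -/
lemma exists_green_sub_greenLow_le {d : ℕ} (hd : 3 ≤ d) :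
    ∃ C : ℝ, 0 < C ∧ ∀ (N : ℕ) (x y : Fin d → ℤ), 0 < N →
      green x y - greenLow N x y ≤ C * (N : ℝ) ^ (-(1 / 4) : ℝ) := by
  obtain ⟨C, hC0, hC⟩ := exists_walkProb_le hd
  have hs : Summable fun n : ℕ => ((n : ℝ) + 1) ^ (-(5 / 4) : ℝ) := by
    have := (summable_nat_add_iff 1).2
      (Real.summable_nat_rpow.2 (by norm_num : (-(5 / 4) : ℝ) < -1))
    simpa using this
  obtain ⟨S, hSdef⟩ : ∃ S : ℝ, S = ∑' n : ℕ, ((n : ℝ) + 1) ^ (-(5 / 4) : ℝ) := ⟨_, rfl⟩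
  have hS : 0 ≤ S := hSdef ▸ tsum_nonneg fun n => by positivity
  refine ⟨C * (S + 1), by positivity, fun N x y hN => ?_⟩
  have hN' : (0 : ℝ) < N := by exact_mod_cast hN
  have hsum := summable_walkProb hd x y
  have h1 : green x y - greenLow N x y = ∑' n : ℕ, walkProb (n + 2 * N) x y := by
    rw [green, greenLow, ← hsum.sum_add_tsum_nat_add (2 * N)]; ring
  rw [h1]
  have h2 : ∀ n : ℕ, walkProb (n + 2 * N) x y ≤
      (C * (N : ℝ) ^ (-(1 / 4) : ℝ)) * ((n : ℝ) + 1) ^ (-(5 / 4) : ℝ) := by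
    intro n
    refine (hC _ _ _).trans ?_
    rw [mul_assoc]
    refine mul_le_mul_of_nonneg_left ?_ hC0.le
    have e : (-(3 / 2) : ℝ) = -(1 / 4) + -(5 / 4) := by norm_num
    have hp : (0 : ℝ) < ((n + 2 * N : ℕ) : ℝ) + 1 := by positivity
    rw [e, Real.rpow_add hp]
    refine mul_le_mul ?_ ?_ (by positivity) (by positivity)
    · refine Real.rpow_le_rpow_of_nonpos hN' ?_ (by norm_num)
      push_cast; linarith [Nat.cast_nonneg (α := ℝ) n]
    · refine Real.rpow_le_rpow_of_nonpos (by positivity) ?_ (by norm_num)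
      push_cast; linarith
  have hsum' : Summable fun n : ℕ => walkProb (n + 2 * N) x y :=
    (summable_nat_add_iff (f := fun n => walkProb n x y) (2 * N)).2 hsum
  calc ∑' n : ℕ, walkProb (n + 2 * N) x y
      ≤ ∑' n : ℕ, (C * (N : ℝ) ^ (-(1 / 4) : ℝ)) * ((n : ℝ) + 1) ^ (-(5 / 4) : ℝ) :=
        Summable.tsum_le_tsum h2 hsum' (hs.mul_left _)
    _ = C * (N : ℝ) ^ (-(1 / 4) : ℝ) * S := by rw [tsum_mul_left, hSdef]
    _ ≤ C * (N : ℝ) ^ (-(1 / 4) : ℝ) * (S + 1) := by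
        refine mul_le_mul_of_nonneg_left (by linarith) (by positivity)
    _ = C * (S + 1) * (N : ℝ) ^ (-(1 / 4) : ℝ) := by ring

/-- A single odd kernel need not be positive, but an even-odd pair has symbol `s ^ (2 k) (1 + s) ≥
0`. This is why the truncation keeps an even number of terms. -/
lemma sum_sum_greenLow_mono {d : ℕ} (hd : 0 < d) (K : Finset (Fin d → ℤ))
    (a : (Fin d → ℤ) → ℝ) :
    Monotone fun N => ∑ x ∈ K, ∑ y ∈ K, a x * a y * greenLow N x y := by
  refine monotone_nat_of_le_succ fun N => ?_
  have h : ∀ x y : Fin d → ℤ, greenLow (N + 1) x y =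
      greenLow N x y + (walkProb (2 * N) x y + walkProb (2 * N + 1) x y) := by
    intro x y
    rw [greenLow, greenLow, show 2 * (N + 1) = 2 * N + 1 + 1 by ring, Finset.sum_range_succ,
      Finset.sum_range_succ, add_assoc]
  simp_rw [h, mul_add, Finset.sum_add_distrib]
  have := sum_sum_walkProb_even_add_odd_nonneg hd N K a
  linarith

lemma sum_sum_greenLow_nonneg {d : ℕ} (hd : 0 < d) (K : Finset (Fin d → ℤ))
    (a : (Fin d → ℤ) → ℝ) (N : ℕ) :
    0 ≤ ∑ x ∈ K, ∑ y ∈ K, a x * a y * greenLow N x y := by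
  simpa [greenLow] using sum_sum_greenLow_mono hd K a (Nat.zero_le N)

lemma sum_sum_greenLow_le {d : ℕ} (hd : 3 ≤ d) (K : Finset (Fin d → ℤ))
    (a : (Fin d → ℤ) → ℝ) (N : ℕ) :
    ∑ x ∈ K, ∑ y ∈ K, a x * a y * greenLow N x y ≤ ∑ x ∈ K, ∑ y ∈ K, a x * a y * green x y := by
  refine (sum_sum_greenLow_mono (by omega) K a).ge_of_tendsto ?_ N
  refine tendsto_finsetSum _ fun x _ => tendsto_finsetSum _ fun y _ => Tendsto.const_mul _ ?_
  exact (summable_walkProb hd x y).hasSum.tendsto_sum_nat.comp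
    (tendsto_id.const_mul_atTop' (by norm_num : 0 < 2))

lemma norm_unitStep {d : ℕ} (s : Fin d × Bool) : ‖unitStep s‖ ≤ 1 := by
  rw [unitStep, Pi.norm_single]
  split_ifs <;> simp

lemma walkProb_eq_zero_of_lt {d : ℕ} {n : ℕ} {x y : Fin d → ℤ} (h : (n : ℝ) < dist x y) :
    walkProb n x y = 0 := by
  rw [walkProb]
  have : IsEmpty {s : Fin n → Fin d × Bool // x + ∑ k, unitStep (s k) = y} := by
    refine ⟨fun ⟨s, hs⟩ => ?_⟩
    have : dist x y ≤ n := by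
      rw [dist_comm, dist_eq_norm, ← hs, add_sub_cancel_left]
      calc _ ≤ ∑ k, ‖unitStep (s k)‖ := norm_sum_le _ _
        _ ≤ ∑ _k : Fin n, (1 : ℝ) := Finset.sum_le_sum fun k _ => norm_unitStep _
        _ = n := by simp
    linarith
  simp

/-- The longest walk counted has `2 N - 1` steps, so distance exactly `2 N` already suffices. -/
lemma greenLow_eq_zero {d : ℕ} {N : ℕ} {x y : Fin d → ℤ} (h : (2 * N : ℝ) ≤ dist x y) :
    greenLow N x y = 0 := by
  refine Finset.sum_eq_zero fun n hn => walkProb_eq_zero_of_lt ?_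
  have : (n : ℝ) < ((2 * N : ℕ) : ℝ) := by exact_mod_cast Finset.mem_range.1 hn
  push_cast at this
  linarith

lemma walkProb_add_right {d : ℕ} (n : ℕ) (x y z : Fin d → ℤ) :
    walkProb n (x + z) (y + z) = walkProb n x y := by
  rw [walkProb, walkProb]
  congr 2
  refine Fintype.card_congr (Equiv.subtypeEquivRight fun s => ?_)
  rw [add_right_comm, add_left_inj]

lemma green_add_right {d : ℕ} (x y z : Fin d → ℤ) : green (x + z) (y + z) = green x y := by
  simp only [green, walkProb_add_right]

/-- The linear regression of the field at `x` on the field in a set at distance at least `2 N` from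
`x` has small variance. -/
lemma regression_variance_le {d : ℕ} (hd : 3 ≤ d) {N : ℕ} (hN : 0 < N) {K : Finset (Fin d → ℤ)}
    {x : Fin d → ℤ} (hx : ∀ y ∈ K, (2 * N : ℝ) ≤ dist x y) {a : (Fin d → ℤ) → ℝ}
    (ha : ∀ y ∈ K, ∑ z ∈ K, a z * green z y = green x y)
    (hsymm : ∀ y ∈ K, green y x = green x y) :
    ∑ z ∈ K, ∑ y ∈ K, a z * a y * green z y ≤ green x x - greenLow N x x := by
  classical
  have hxK : x ∉ K := fun h => by
    have := hx x h
    rw [dist_self] at this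
    have : (0 : ℝ) < N := by exact_mod_cast hN
    linarith
  -- By the normal equations, the variance of the regression equals its covariance with the field at
  -- `x`.
  have hB : ∑ z ∈ K, ∑ y ∈ K, a z * a y * green z y = ∑ y ∈ K, a y * green x y := by
    rw [Finset.sum_comm]
    refine Finset.sum_congr rfl fun y hy => ?_
    rw [← ha y hy, Finset.mul_sum]
    exact Finset.sum_congr rfl fun z _ => by ring
  -- With weight `-1` at `x`, the Green form of `b` is the residual variance `g(x, x)` minus the
  -- regression variance. It dominates the truncated form, whose cross terms vanish and which is
  -- therefore at least `greenLow N x x`.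
  set b : (Fin d → ℤ) → ℝ := fun z => if z = x then -1 else a z with hb
  have hbx : b x = -1 := by simp [hb]
  have hbK : ∀ z ∈ K, b z = a z := fun z hz => by
    simp [hb, show z ≠ x from fun h => hxK (h ▸ hz)]
  have expand : ∀ k : (Fin d → ℤ) → (Fin d → ℤ) → ℝ,
      ∑ z ∈ insert x K, ∑ y ∈ insert x K, b z * b y * k z y =
        k x x - ∑ y ∈ K, a y * k x y - ∑ z ∈ K, a z * k z x +
          ∑ z ∈ K, ∑ y ∈ K, a z * a y * k z y := by
    intro k
    rw [Finset.sum_insert hxK, Finset.sum_insert hxK]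
    simp_rw [Finset.sum_insert hxK, Finset.sum_add_distrib]
    have e1 : ∑ y ∈ K, b x * b y * k x y = - ∑ y ∈ K, a y * k x y := by
      rw [← Finset.sum_neg_distrib]
      exact Finset.sum_congr rfl fun y hy => by rw [hbx, hbK y hy]; ring
    have e2 : ∑ z ∈ K, b z * b x * k z x = - ∑ z ∈ K, a z * k z x := by
      rw [← Finset.sum_neg_distrib]
      exact Finset.sum_congr rfl fun y hy => by rw [hbx, hbK y hy]; ring
    have e3 : ∑ z ∈ K, ∑ y ∈ K, b z * b y * k z y = ∑ z ∈ K, ∑ y ∈ K, a z * a y * k z y :=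
      Finset.sum_congr rfl fun z hz => Finset.sum_congr rfl fun y hy => by
        rw [hbK z hz, hbK y hy]
    rw [e1, e2, e3, hbx]
    ring
  have h1 := sum_sum_greenLow_le hd (insert x K) b N
  rw [expand, expand] at h1
  have h2 := sum_sum_greenLow_nonneg (by omega) K a N
  have z1 : ∑ y ∈ K, a y * greenLow N x y = 0 :=
    Finset.sum_eq_zero fun y hy => by rw [greenLow_eq_zero (hx y hy), mul_zero]
  have z2 : ∑ y ∈ K, a y * greenLow N y x = 0 :=
    Finset.sum_eq_zero fun y hy => by
      rw [greenLow_eq_zero (by rw [dist_comm]; exact hx y hy), mul_zero]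
  have z3 : ∑ y ∈ K, a y * green y x = ∑ y ∈ K, a y * green x y :=
    Finset.sum_congr rfl fun y hy => by rw [hsymm y hy]
  rw [z1, z2, z3] at h1
  linarith

/-! ### Level events, Gaussian tails and projections -/

/-- The event that the field is at least `h` throughout some member of the family `𝒮`. -/
def levelEvent {d : ℕ} (𝒮 : Set (Finset (Fin d → ℤ))) (h : ℝ) : Set ((Fin d → ℤ) → ℝ) :=
  {φ | ∃ S ∈ 𝒮, ∀ z ∈ S, h ≤ φ z}

lemma measurableSet_levelEvent {d : ℕ} (𝒮 : Set (Finset (Fin d → ℤ))) (h : ℝ) :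
    MeasurableSet (levelEvent 𝒮 h) := by
  have : levelEvent 𝒮 h = ⋃ S ∈ 𝒮, ⋂ z ∈ S, {φ : (Fin d → ℤ) → ℝ | h ≤ φ z} := by
    ext φ; simp [levelEvent]
  rw [this]
  refine MeasurableSet.biUnion (Set.to_countable _) fun S _ => ?_
  refine Finset.measurableSet_biInter S fun z _ => ?_
  exact measurableSet_le measurable_const (measurable_pi_apply z)

/-- A centered Gaussian variable is sub-Gaussian with any variance proxy above its variance. -/
lemma measureReal_ge_le_of_hasGaussianLaw {Ω : Type*} {mΩ : MeasurableSpace Ω} {P : Measure Ω}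
    {X : Ω → ℝ} (hX : HasGaussianLaw X P) (h0 : ∫ ω, X ω ∂P = 0) {v : ℝ} (hv : ∫ ω, X ω ^ 2 ∂P ≤ v)
    {t : ℝ} (ht : 0 ≤ t) : P.real {ω | t ≤ X ω} ≤ Real.exp (-t ^ 2 / (2 * v)) := by
  have := hX.isProbabilityMeasure
  have hvar : Var[X; P] = ∫ ω, X ω ^ 2 ∂P := variance_of_integral_eq_zero hX.aemeasurable h0
  have hv0 : 0 ≤ v := le_trans (integral_nonneg fun ω => sq_nonneg _) hv
  have hmap := hX.map_eq_gaussianReal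
  rw [h0] at hmap
  have hsub : HasSubgaussianMGF X ⟨v, hv0⟩ P := by
    constructor
    · intro s
      have h1 : Integrable (fun x : ℝ => Real.exp (s * x)) (P.map X) := by
        rw [hmap]; exact integrable_exp_mul_gaussianReal s
      exact h1.comp_aemeasurable hX.aemeasurable
    · intro s
      rw [mgf_gaussianReal hmap]
      simp only [zero_mul, zero_add]
      gcongr
      rw [Real.coe_toNNReal _ (variance_nonneg _ _), hvar]
      exact hv
  exact hsub.measure_ge_le ht

lemma measureReal_abs_gt_le_of_hasGaussianLaw {Ω : Type*} {mΩ : MeasurableSpace Ω} {P : Measure Ω}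
    {X : Ω → ℝ} (hX : HasGaussianLaw X P) (h0 : ∫ ω, X ω ∂P = 0) {v : ℝ} (hv : ∫ ω, X ω ^ 2 ∂P ≤ v)
    {t : ℝ} (ht : 0 ≤ t) : P.real {ω | t < |X ω|} ≤ 2 * Real.exp (-t ^ 2 / (2 * v)) := by
  have := hX.isProbabilityMeasure
  have h1 := measureReal_ge_le_of_hasGaussianLaw hX h0 hv ht
  have h2 := measureReal_ge_le_of_hasGaussianLaw hX.neg (v := v) (t := t)
    (by simp [integral_neg, h0]) (by simpa using hv) ht
  have hsub : {ω | t < |X ω|} ⊆ {ω | t ≤ X ω} ∪ {ω | t ≤ (-X) ω} := by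
    intro ω hω
    rcases lt_abs.1 (show t < |X ω| from hω) with h | h
    · exact Or.inl h.le
    · exact Or.inr h.le
  calc _ ≤ _ := measureReal_mono hsub
    _ ≤ _ := measureReal_union_le _ _
    _ ≤ _ := by linarith

/-- Normal equations of the orthogonal projection on a finite-dimensional span. -/
lemma exists_normal_equations {E ι : Type*} [NormedAddCommGroup E] [InnerProductSpace ℝ E]
    (v : ι → E) (K : Finset ι) (u : E) :
    ∃ a : ι → ℝ, ∀ y ∈ K, ∑ z ∈ K, a z * inner ℝ (v z) (v y) = inner ℝ u (v y) := by
  classical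
  set U : Submodule ℝ E := Submodule.span ℝ (v '' K) with hU
  have : FiniteDimensional ℝ U := FiniteDimensional.span_of_finite ℝ (K.finite_toSet.image v)
  obtain ⟨a, ha⟩ := (Submodule.mem_span_image_finset_iff_exists_fun ℝ).1
    (Submodule.starProjection_apply_mem U u)
  refine ⟨fun z => if h : z ∈ K then a ⟨z, h⟩ else 0, fun y hy => ?_⟩
  have h1 : inner ℝ (u - U.starProjection u) (v y) = 0 := by
    rw [real_inner_comm]
    exact Submodule.inner_right_of_mem_orthogonal
      (Submodule.subset_span (Set.mem_image_of_mem v hy))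
      (Submodule.sub_starProjection_mem_orthogonal u)
  rw [inner_sub_left, sub_eq_zero] at h1
  rw [h1, ← ha, sum_inner, ← Finset.sum_coe_sort]
  exact Finset.sum_congr rfl fun z _ => by
    rw [real_inner_smul_left]; simp

/-! ### Regression, stationarity and decoupling of the free field -/

namespace IsGaussianFreeField

variable {d : ℕ} {P : Measure ((Fin d → ℤ) → ℝ)}

lemma isProbabilityMeasure (hP : IsGaussianFreeField d P) : IsProbabilityMeasure P :=
  hP.gaussian.isProbabilityMeasure

lemma memLp_eval (hP : IsGaussianFreeField d P) (x : Fin d → ℤ) :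
    MemLp (fun φ : (Fin d → ℤ) → ℝ => φ x) 2 P :=
  (hP.gaussian.hasGaussianLaw_eval x).memLp_two

lemma integrable_mul (hP : IsGaussianFreeField d P) (x y : Fin d → ℤ) :
    Integrable (fun φ : (Fin d → ℤ) → ℝ => φ x * φ y) P :=
  (hP.memLp_eval x).integrable_mul (hP.memLp_eval y)

lemma green_comm (hP : IsGaussianFreeField d P) (x y : Fin d → ℤ) : green x y = green y x := by
  rw [← hP.covariance, ← hP.covariance]
  simp_rw [mul_comm]

lemma integral_sum (hP : IsGaussianFreeField d P) {ι : Type*} (K : Finset ι)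
    (p : ι → Fin d → ℤ) (a : ι → ℝ) :
    ∫ φ, ∑ z ∈ K, a z * φ (p z) ∂P = 0 := by
  have := hP.isProbabilityMeasure
  rw [integral_finsetSum]
  · exact Finset.sum_eq_zero fun z _ => by rw [integral_const_mul, hP.centered, mul_zero]
  · exact fun z _ => ((hP.memLp_eval (p z)).integrable (by norm_num)).const_mul _

lemma integral_mul_sum (hP : IsGaussianFreeField d P) {ι : Type*} (y : Fin d → ℤ) (K : Finset ι)
    (p : ι → Fin d → ℤ) (a : ι → ℝ) :
    ∫ φ, φ y * ∑ z ∈ K, a z * φ (p z) ∂P = ∑ z ∈ K, a z * green (p z) y := by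
  simp_rw [Finset.mul_sum]
  rw [integral_finsetSum]
  · refine Finset.sum_congr rfl fun z _ => ?_
    rw [← hP.covariance, ← integral_const_mul]
    congr 1; ext φ; ring
  · intro z _
    refine ((hP.integrable_mul (p z) y).const_mul (a z)).congr (ae_of_all _ fun φ => ?_)
    ring

lemma integral_sum_sq (hP : IsGaussianFreeField d P) {ι : Type*} (K : Finset ι)
    (p : ι → Fin d → ℤ) (a : ι → ℝ) :
    ∫ φ, (∑ z ∈ K, a z * φ (p z)) ^ 2 ∂P = ∑ z ∈ K, ∑ y ∈ K, a z * a y * green (p z) (p y) := by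
  have e : ∀ φ : (Fin d → ℤ) → ℝ, (∑ z ∈ K, a z * φ (p z)) ^ 2 =
      ∑ z ∈ K, ∑ y ∈ K, a z * a y * (φ (p z) * φ (p y)) := by
    intro φ
    rw [sq, Finset.sum_mul_sum]
    exact Finset.sum_congr rfl fun z _ => Finset.sum_congr rfl fun y _ => by ring
  simp_rw [e]
  rw [integral_finsetSum]
  · refine Finset.sum_congr rfl fun z _ => ?_
    rw [integral_finsetSum]
    · exact Finset.sum_congr rfl fun y _ => by rw [integral_const_mul, hP.covariance]
    · exact fun y _ => (hP.integrable_mul _ _).const_mul _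
  · exact fun z _ => integrable_finsetSum _ fun y _ => (hP.integrable_mul _ _).const_mul _

/-- Projecting in `L²` solves the normal equations without inverting the Green matrix. -/
lemma exists_regression (hP : IsGaussianFreeField d P) (K : Finset (Fin d → ℤ)) (x : Fin d → ℤ) :
    ∃ a : (Fin d → ℤ) → ℝ, ∀ y ∈ K, ∑ z ∈ K, a z * green z y = green x y := by
  obtain ⟨a, ha⟩ := exists_normal_equations (fun z => (hP.memLp_eval z).toLp) K
    (hP.memLp_eval x).toLp
  have hin : ∀ z y : Fin d → ℤ,
      inner ℝ (hP.memLp_eval z).toLp (hP.memLp_eval y).toLp = green z y := by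
    intro z y
    rw [L2.inner_def, ← hP.covariance]
    refine integral_congr_ae ?_
    filter_upwards [(hP.memLp_eval z).coeFn_toLp, (hP.memLp_eval y).coeFn_toLp] with φ h1 h2
    rw [h1, h2]
    simp [mul_comm]
  refine ⟨a, fun y hy => ?_⟩
  have := ha y hy
  simpa only [hin] using this

/-- Finite-dimensional Gaussian laws are determined by mean and covariance, and the Green function
is translation invariant. -/
lemma map_translate (hP : IsGaussianFreeField d P) (w : Fin d → ℤ) :
    P.map (fun φ x => φ (x + w)) = P := by
  have := hP.isProbabilityMeasure
  have hmeas : ∀ u : Fin d → ℤ,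
      Measurable fun (φ : (Fin d → ℤ) → ℝ) (x : Fin d → ℤ) => φ (x + u) :=
    fun u => measurable_pi_lambda _ fun x => measurable_pi_apply _
  have key := (map_eq_iff_forall_finset_map_restrict_eq (P := P)
    (X := fun (x : Fin d → ℤ) φ => φ (x + w)) (Y := fun (x : Fin d → ℤ) φ => φ x)
    (hmeas w).aemeasurable (measurable_id.aemeasurable)).2
  refine (key fun I => ?_).trans Measure.map_id
  have hX : HasGaussianLaw (fun φ : (Fin d → ℤ) → ℝ => I.restrict fun x => φ (x + w)) P :=
    (hP.gaussian.comp_right (fun x => x + w)).hasGaussianLaw I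
  have hY : HasGaussianLaw (fun φ : (Fin d → ℤ) → ℝ => I.restrict fun x => φ x) P :=
    hP.gaussian.hasGaussianLaw I
  have := hX.isGaussian_map
  have := hY.isGaussian_map
  refine Measure.ext_of_charFunDual (funext fun L => ?_)
  rw [hX.charFunDual_map_eq, hY.charFunDual_map_eq]
  have hL : ∀ f : I → ℝ, L f = ∑ i, L (Pi.single i 1) * f i := by
    intro f
    conv_lhs => rw [← Finset.univ_sum_single f]
    rw [map_sum]
    refine Finset.sum_congr rfl fun i _ => ?_
    rw [show (Pi.single i (f i) : I → ℝ) = f i • Pi.single i 1 by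
      rw [← Pi.single_smul, smul_eq_mul, mul_one], map_smul, smul_eq_mul, mul_comm]
  have e1 : (L ∘ fun φ : (Fin d → ℤ) → ℝ => I.restrict fun x => φ (x + w)) =
      fun φ => ∑ i : I, L (Pi.single i 1) * φ (i + w) := by
    ext φ; exact hL _
  have e2 : (L ∘ fun φ : (Fin d → ℤ) → ℝ => I.restrict fun x => φ x) =
      fun φ => ∑ i : I, L (Pi.single i 1) * φ i := by
    ext φ; exact hL _
  rw [e1, e2, hP.integral_sum Finset.univ (fun i : I => (i : Fin d → ℤ) + w),
    hP.integral_sum Finset.univ (fun i : I => (i : Fin d → ℤ)),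
    variance_of_integral_eq_zero (Measurable.aemeasurable (by fun_prop))
      (hP.integral_sum Finset.univ (fun i : I => (i : Fin d → ℤ) + w) _),
    variance_of_integral_eq_zero (Measurable.aemeasurable (by fun_prop))
      (hP.integral_sum Finset.univ (fun i : I => (i : Fin d → ℤ)) _),
    hP.integral_sum_sq Finset.univ (fun i : I => (i : Fin d → ℤ) + w),
    hP.integral_sum_sq Finset.univ (fun i : I => (i : Fin d → ℤ))]
  simp_rw [green_add_right]

lemma measureReal_levelEvent_translate (hP : IsGaussianFreeField d P) (w : Fin d → ℤ)
    (𝒮 : Set (Finset (Fin d → ℤ))) (h : ℝ) :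
    P.real {φ | (fun x => φ (x + w)) ∈ levelEvent 𝒮 h} = P.real (levelEvent 𝒮 h) := by
  conv_rhs => rw [← hP.map_translate w]
  rw [measureReal_def, measureReal_def, Measure.map_apply
    (measurable_pi_lambda _ fun x => measurable_pi_apply _) (measurableSet_levelEvent 𝒮 h)]
  rfl

/-- A finite linear combination of coordinates, as a continuous linear functional of the
restricted field. -/
def coordComb (K : Finset (Fin d → ℤ)) (b : (Fin d → ℤ) → ℝ) : (K → ℝ) →L[ℝ] ℝ :=
  ∑ z : K, b z • ContinuousLinearMap.proj z

lemma coordComb_restrict (K : Finset (Fin d → ℤ)) (b φ : (Fin d → ℤ) → ℝ) :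
    coordComb K b (K.restrict φ) = ∑ z ∈ K, b z * φ z := by
  simp only [coordComb, sum_apply, smul_apply,
    ContinuousLinearMap.proj_apply, smul_eq_mul, Finset.restrict]
  exact Finset.sum_coe_sort K fun z => b z * φ z

lemma hasGaussianLaw_sum (hP : IsGaussianFreeField d P) (K : Finset (Fin d → ℤ))
    (b : (Fin d → ℤ) → ℝ) :
    HasGaussianLaw (fun φ : (Fin d → ℤ) → ℝ => ∑ z ∈ K, b z * φ z) P := by
  have h := (hP.gaussian.hasGaussianLaw K).map_fun (coordComb K b)
  simpa only [coordComb_restrict] using h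

/-- Subtracting from the field in `K₂` its linear regression on the field in `K₁` makes it
independent of the field in `K₁`. -/
lemma indepFun_regression (hP : IsGaussianFreeField d P) {K₁ K₂ : Finset (Fin d → ℤ)}
    (hK : Disjoint K₁ K₂)
    {a : (Fin d → ℤ) → (Fin d → ℤ) → ℝ}
    (ha : ∀ x, ∀ y ∈ K₁, ∑ z ∈ K₁, a x z * green z y = green x y) :
    IndepFun (fun (φ : (Fin d → ℤ) → ℝ) y => if y ∈ K₁ then φ y else 0)
      (fun (φ : (Fin d → ℤ) → ℝ) x => if x ∈ K₂ then φ x - ∑ z ∈ K₁, a x z * φ z else 0) P := by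
  classical
  have := hP.isProbabilityMeasure
  have hmX : ∀ y, Measurable fun φ : (Fin d → ℤ) → ℝ => if y ∈ K₁ then φ y else 0 := by
    intro y; split_ifs <;> fun_prop
  have hmY : ∀ x, Measurable fun φ : (Fin d → ℤ) → ℝ =>
      if x ∈ K₂ then φ x - ∑ z ∈ K₁, a x z * φ z else 0 := by
    intro x; split_ifs <;> fun_prop
  refine IsGaussianProcess.indepFun_of_covariance_eq_zero
    (X := fun y (φ : (Fin d → ℤ) → ℝ) => if y ∈ K₁ then φ y else 0)
    (Y := fun x (φ : (Fin d → ℤ) → ℝ) => if x ∈ K₂ then φ x - ∑ z ∈ K₁, a x z * φ z else 0)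
    ?_ (fun y => (hmX y).aemeasurable) (fun x => (hmY x).aemeasurable) ?_
  -- Joint Gaussianity: each coordinate of either family is a linear functional of finitely many
  -- field values. Independence then reduces to vanishing cross-covariances, which are the normal
  -- equations.
  · refine hP.gaussian.of_isGaussianProcess ?_
    rintro (y | x)
    · refine ⟨{y}, coordComb {y} fun _ => if y ∈ K₁ then 1 else 0, fun φ => ?_⟩
      rw [coordComb_restrict, Finset.sum_singleton]
      simp
    · refine ⟨insert x K₁, coordComb (insert x K₁)
        fun z => if x ∈ K₂ then (if z = x then 1 else -a x z) else 0, fun φ => ?_⟩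
      rw [coordComb_restrict]
      by_cases hx : x ∈ K₂
      · have hx1 : x ∉ K₁ := fun h => Finset.disjoint_left.1 hK h hx
        simp only [Sum.elim_inr, hx, if_true]
        rw [Finset.sum_insert hx1, if_pos rfl, one_mul, sub_eq_add_neg, ← Finset.sum_neg_distrib]
        congr 1
        refine Finset.sum_congr rfl fun z hz => ?_
        rw [if_neg (show z ≠ x from fun h => hx1 (h ▸ hz)), neg_mul]
      · simp [hx]
  · intro y x
    by_cases hy : y ∈ K₁
    · by_cases hx : x ∈ K₂
      · simp only [hy, hx, if_true]
        have hms : MemLp (fun φ : (Fin d → ℤ) → ℝ => ∑ z ∈ K₁, a x z * φ z) 2 P :=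
          (hP.hasGaussianLaw_sum K₁ (a x)).memLp_two
        have hmd : MemLp (fun φ : (Fin d → ℤ) → ℝ => φ x - ∑ z ∈ K₁, a x z * φ z) 2 P :=
          (hP.memLp_eval x).sub hms
        rw [covariance_eq_sub (hP.memLp_eval y) hmd, hP.centered, zero_mul,
          sub_zero]
        have e : ∀ φ : (Fin d → ℤ) → ℝ, ((fun φ : (Fin d → ℤ) → ℝ => φ y) *
            (fun φ : (Fin d → ℤ) → ℝ => φ x - ∑ z ∈ K₁, a x z * φ z)) φ =
            φ y * φ x - φ y * ∑ z ∈ K₁, a x z * φ z := by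
          intro φ; simp [mul_sub]
        have hi : Integrable (fun φ : (Fin d → ℤ) → ℝ => φ y * ∑ z ∈ K₁, a x z * φ z) P :=
          (hP.memLp_eval y).integrable_mul hms
        simp_rw [e]
        rw [integral_sub (hP.integrable_mul y x) hi,
          hP.covariance, hP.integral_mul_sum y K₁ (fun z => z), ha x y hy, hP.green_comm, sub_self]
      · simp [hx]
    · simp [hy]

/-- Decoupling with sprinkling for increasing events in two distant sets. -/
lemma measureReal_inter_levelEvent_le (hP : IsGaussianFreeField d P) (hd : 3 ≤ d) {N : ℕ}
    (hN : 0 < N) {K₁ K₂ : Finset (Fin d → ℤ)}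
    (hK : ∀ x ∈ K₂, ∀ y ∈ K₁, (2 * N : ℝ) ≤ dist x y)
    {𝒮₁ 𝒮₂ : Set (Finset (Fin d → ℤ))} (h₁ : ∀ S ∈ 𝒮₁, S ⊆ K₁) (h₂ : ∀ S ∈ 𝒮₂, S ⊆ K₂)
    {v : ℝ} (hv : ∀ x : Fin d → ℤ, green x x - greenLow N x x ≤ v) (h : ℝ) {δ : ℝ} (hδ : 0 ≤ δ) :
    P.real (levelEvent 𝒮₁ h ∩ levelEvent 𝒮₂ h) ≤
      P.real (levelEvent 𝒮₁ h) * P.real (levelEvent 𝒮₂ (h - δ)) +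
        2 * (K₂.card * (2 * Real.exp (-(δ / 2) ^ 2 / (2 * v)))) := by
  classical
  have := hP.isProbabilityMeasure
  choose a ha using hP.exists_regression K₁
  set ξ : (Fin d → ℤ) → ((Fin d → ℤ) → ℝ) → ℝ := fun x φ => ∑ z ∈ K₁, a x z * φ z with hξ
  set bad : Set ((Fin d → ℤ) → ℝ) := ⋃ x ∈ K₂, {φ | δ / 2 < |ξ x φ|} with hbad
  have hbadP : P.real bad ≤ K₂.card * (2 * Real.exp (-(δ / 2) ^ 2 / (2 * v))) := by
    calc P.real bad ≤ ∑ x ∈ K₂, P.real {φ | δ / 2 < |ξ x φ|} :=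
          measureReal_biUnion_finset_le _ _
      _ ≤ ∑ _x ∈ K₂, 2 * Real.exp (-(δ / 2) ^ 2 / (2 * v)) := by
          refine Finset.sum_le_sum fun x hx => ?_
          refine measureReal_abs_gt_le_of_hasGaussianLaw (hP.hasGaussianLaw_sum K₁ (a x))
            (hP.integral_sum K₁ (fun z => z) (a x)) ?_ (by linarith)
          rw [hP.integral_sum_sq K₁ (fun z => z) (a x)]
          exact (regression_variance_le hd hN (hK x hx) (ha x)
            fun y _ => hP.green_comm y x).trans (hv x)
      _ = _ := by simp
  have hdisj : Disjoint K₁ K₂ := by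
    rw [Finset.disjoint_left]
    intro x hx1 hx2
    have := hK x hx2 x hx1
    rw [dist_self] at this
    have : (0 : ℝ) < N := by exact_mod_cast hN
    linarith
  have hind := hP.indepFun_regression hdisj ha
  set X : ((Fin d → ℤ) → ℝ) → (Fin d → ℤ) → ℝ := fun φ y => if y ∈ K₁ then φ y else 0 with hX
  -- Padding with zeros makes `X` and `Y` fields on the whole lattice, so level events can be pulled
  -- back along them; the padding is invisible to sets inside `K₁` and `K₂`.
  set Y : ((Fin d → ℤ) → ℝ) → (Fin d → ℤ) → ℝ :=
    fun φ x => if x ∈ K₂ then φ x - ∑ z ∈ K₁, a x z * φ z else 0 with hY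
  have hX1 : X ⁻¹' levelEvent 𝒮₁ h = levelEvent 𝒮₁ h := by
    ext φ
    simp only [Set.mem_preimage, levelEvent, Set.mem_ofPred_eq]
    refine exists_congr fun S => and_congr_right fun hS => forall₂_congr fun z hz => ?_
    simp [hX, h₁ S hS hz]
  have hprod : P.real (levelEvent 𝒮₁ h ∩ Y ⁻¹' levelEvent 𝒮₂ (h - δ / 2)) =
      P.real (levelEvent 𝒮₁ h) * P.real (Y ⁻¹' levelEvent 𝒮₂ (h - δ / 2)) := by
    have := hind.measure_inter_preimage_eq_mul _ _ (measurableSet_levelEvent 𝒮₁ h)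
      (measurableSet_levelEvent 𝒮₂ (h - δ / 2))
    rw [hX1] at this
    rw [measureReal_def, this, ENNReal.toReal_mul]; rfl
  -- Off `bad`, passing from the field to the residual costs `δ / 2`, and passing back in `hsub2`
  -- costs another `δ / 2`. Each passage adds one copy of `P bad`.
  have hsub1 : levelEvent 𝒮₁ h ∩ levelEvent 𝒮₂ h ⊆
      (levelEvent 𝒮₁ h ∩ Y ⁻¹' levelEvent 𝒮₂ (h - δ / 2)) ∪ bad := by
    rintro φ ⟨hφ1, S, hS, hφ⟩
    by_cases hb : φ ∈ bad
    · exact Or.inr hb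
    · refine Or.inl ⟨hφ1, S, hS, fun z hz => ?_⟩
      simp only [hbad, Set.mem_iUnion, Set.mem_ofPred_eq, not_exists, not_lt] at hb
      have h3 := abs_le.1 (hb z (h₂ S hS hz))
      have h4 := hφ z hz
      simp only [hY, h₂ S hS hz, if_true]
      simp only [hξ] at h3
      linarith
  have hsub2 : Y ⁻¹' levelEvent 𝒮₂ (h - δ / 2) ⊆ levelEvent 𝒮₂ (h - δ) ∪ bad := by
    rintro φ ⟨S, hS, hφ⟩
    by_cases hb : φ ∈ bad
    · exact Or.inr hb
    · refine Or.inl ⟨S, hS, fun z hz => ?_⟩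
      simp only [hbad, Set.mem_iUnion, Set.mem_ofPred_eq, not_exists, not_lt] at hb
      have h3 := abs_le.1 (hb z (h₂ S hS hz))
      have h4 := hφ z hz
      simp only [hY, h₂ S hS hz, if_true] at h4
      simp only [hξ] at h3
      linarith
  have b1 := (measureReal_mono (μ := P) hsub1).trans (measureReal_union_le _ _)
  have b2 := (measureReal_mono (μ := P) hsub2).trans (measureReal_union_le _ _)
  have b3 : P.real (levelEvent 𝒮₁ h) ≤ 1 := measureReal_le_one
  have b4 : 0 ≤ P.real (levelEvent 𝒮₁ h) := measureReal_nonneg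
  have b5 : 0 ≤ P.real bad := measureReal_nonneg
  rw [hprod] at b1
  nlinarith [mul_le_mul_of_nonneg_left b2 b4, mul_le_mul_of_nonneg_right b3 b5]

end IsGaussianFreeField

/-! ### Geometry of crossings -/

variable {d : ℕ}

lemma dist_le_natCast_iff {x y : Fin d → ℤ} {n : ℕ} :
    dist x y ≤ n ↔ ∀ i, |x i - y i| ≤ n := by
  rw [dist_pi_le_iff (Nat.cast_nonneg n)]
  refine forall_congr' fun i => ?_
  rw [Int.dist_eq, ← Int.cast_sub, ← Int.cast_abs]
  exact_mod_cast Iff.rfl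

lemma dist_lt_natCast_succ {x y : Fin d → ℤ} {n : ℕ} (h : dist x y < (n + 1 : ℕ)) :
    dist x y ≤ n := by
  rw [dist_pi_lt_iff (by positivity)] at h
  rw [dist_le_natCast_iff]
  intro i
  have := h i
  rw [Int.dist_eq, ← Int.cast_sub, ← Int.cast_abs] at this
  have : |x i - y i| < (n + 1 : ℕ) := by exact_mod_cast this
  push_cast at this
  omega

lemma dist_le_one_of_adj {x y : Fin d → ℤ} (h : (latticeGraph d).Adj x y) : dist x y ≤ 1 := by
  have h' : ∑ i, (x i - y i) ^ 2 = 1 := h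
  have := (dist_le_natCast_iff (x := x) (y := y) (n := 1)).2 fun i => by
    have h1 : (x i - y i) ^ 2 ≤ 1 := h' ▸
      Finset.single_le_sum (f := fun i => (x i - y i) ^ 2) (fun j _ => sq_nonneg _)
        (Finset.mem_univ i)
    rw [Nat.cast_one]
    exact (sq_le_one_iff_abs_le_one _).1 h1
  simpa using this

/-- A walk that starts within distance `R` of `x` and ends at distance at least `R` has an initial
piece that stays within distance `R` and ends at distance exactly `R`. -/
lemma exists_walk_to_sphere (x : Fin d → ℤ) (R : ℕ) {u v : Fin d → ℤ}
    (w : (latticeGraph d).Walk u v) (hu : dist u x ≤ R) (hv : (R : ℝ) ≤ dist v x) :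
    ∃ (v' : Fin d → ℤ) (w' : (latticeGraph d).Walk u v'), dist v' x = R ∧
      ∀ z ∈ w'.support, dist z x ≤ R ∧ z ∈ w.support := by
  induction w with
  | nil => exact ⟨_, .nil, le_antisymm hu hv, fun z hz => ⟨by simp_all, hz⟩⟩
  | @cons a b c hab p ih =>
    rcases hu.eq_or_lt with h | h
    · refine ⟨a, .nil, h, fun z hz => ?_⟩
      have hz' : z = a := by simpa using hz
      subst hz'
      exact ⟨hu, by simp⟩
    · obtain ⟨n, rfl⟩ : ∃ n, R = n + 1 := by
        refine ⟨R - 1, ?_⟩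
        have : (0 : ℝ) < R := lt_of_le_of_lt dist_nonneg h
        have : 0 < R := by exact_mod_cast this
        omega
      -- Distances between lattice points are integers, so one step from inside the sphere cannot
      -- jump over it.
      have h1 := dist_lt_natCast_succ h
      have hb : dist b x ≤ (n + 1 : ℕ) := by
        have := dist_triangle_left b x a
        have := dist_le_one_of_adj hab
        push_cast
        linarith
      obtain ⟨v', w', h2, h3⟩ := ih hb hv
      refine ⟨v', .cons hab w', h2, fun z hz => ?_⟩
      rw [SimpleGraph.Walk.support_cons, List.mem_cons] at hz
      rcases hz with rfl | hz
      · exact ⟨hu, by simp⟩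
      · exact ⟨(h3 z hz).1, by simp [(h3 z hz).2]⟩

/-- The vertex sets of the nearest-neighbor walks in `B(x, 2 L)` from `B(x, L)` to `S(x, 2 L)`. -/
def crossFamily (x : Fin d → ℤ) (L : ℕ) : Set (Finset (Fin d → ℤ)) :=
  {S | ∃ (u v : Fin d → ℤ) (w : (latticeGraph d).Walk u v), dist u x ≤ L ∧
    dist v x = (2 * L : ℕ) ∧ (∀ z ∈ w.support, dist z x ≤ (2 * L : ℕ)) ∧ S = w.support.toFinset}

/-- A path above level `h` that meets `B(x, L)` and the complement of the interior of `B(x, 2 L)`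
produces a crossing of the annulus around `x`. -/
lemma mem_levelEvent_crossFamily {u v : Fin d → ℤ} (w : (latticeGraph d).Walk u v) {h : ℝ}
    {φ : (Fin d → ℤ) → ℝ} (hφ : ∀ z ∈ w.support, h ≤ φ z) {x z₁ z₂ : Fin d → ℤ} {L : ℕ}
    (hz₁ : z₁ ∈ w.support) (hz₂ : z₂ ∈ w.support) (h₁ : dist z₁ x ≤ L)
    (h₂ : (2 * L : ℝ) ≤ dist z₂ x) : φ ∈ levelEvent (crossFamily x L) h := by
  classical
  -- The order of `z₁` and `z₂` along `w` is unknown, so the walk goes from `z₁` back to the start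
  -- of `w` and then out to `z₂`.
  set w₁ := (w.takeUntil z₁ hz₁).reverse.append (w.takeUntil z₂ hz₂) with hw₁
  have hsup : ∀ z ∈ w₁.support, z ∈ w.support := by
    intro z hz
    rw [hw₁, SimpleGraph.Walk.mem_support_append_iff, SimpleGraph.Walk.support_reverse,
      List.mem_reverse] at hz
    rcases hz with hz | hz
    · exact w.support_takeUntil_subset_support hz₁ hz
    · exact w.support_takeUntil_subset_support hz₂ hz
  obtain ⟨v', w', h3, h4⟩ := exists_walk_to_sphere x (2 * L) w₁
    (by push_cast; linarith [Nat.cast_nonneg (α := ℝ) L]) (by push_cast; exact h₂)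
  refine ⟨w'.support.toFinset, ⟨z₁, v', w', h₁, h3, fun z hz => (h4 z hz).1, rfl⟩, fun z hz => ?_⟩
  exact hφ z (hsup z (h4 z (List.mem_toFinset.1 hz)).2)

/-- Translation as a homomorphism of the lattice graph. -/
def translateHom (g : Fin d → ℤ) : latticeGraph d →g latticeGraph d where
  toFun z := z - g
  map_rel' {a b} hab := by
    have h' : ∑ i, (a i - b i) ^ 2 = 1 := hab
    show ∑ i, ((a - g) i - (b - g) i) ^ 2 = 1
    simpa using h'

lemma levelEvent_crossFamily_subset (g : Fin d → ℤ) (L : ℕ) (h : ℝ) :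
    levelEvent (crossFamily g L) h ⊆
      {φ | (fun x => φ (x + g)) ∈ levelEvent (crossFamily 0 L) h} := by
  rintro φ ⟨S, ⟨u, v, w, h1, h2, h3, rfl⟩, hφ⟩
  refine ⟨(w.map (translateHom g)).support.toFinset,
    ⟨_, _, w.map (translateHom g), ?_, ?_, ?_, rfl⟩, fun z hz => ?_⟩
  · show dist (u - g) 0 ≤ L
    rwa [dist_zero_right, ← dist_eq_norm]
  · show dist (v - g) 0 = _
    rwa [dist_zero_right, ← dist_eq_norm]
  · intro z hz
    rw [SimpleGraph.Walk.support_map, List.mem_map] at hz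
    obtain ⟨y, hy, rfl⟩ := hz
    show dist (y - g) 0 ≤ _
    rw [dist_zero_right, ← dist_eq_norm]
    exact h3 y hy
  · rw [List.mem_toFinset, SimpleGraph.Walk.support_map, List.mem_map] at hz
    obtain ⟨y, hy, rfl⟩ := hz
    show h ≤ φ (y - g + g)
    rw [sub_add_cancel]
    exact hφ y (List.mem_toFinset.2 hy)

lemma levelEvent_crossFamily_zero_subset (L : ℕ) (h : ℝ) :
    levelEvent (crossFamily (0 : Fin d → ℤ) L) h ⊆
      connects h (Metric.closedBall 0 (L : ℝ)) (Metric.sphere 0 (2 * L : ℝ)) := by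
  rintro φ ⟨S, ⟨u, v, w, h1, h2, -, rfl⟩, hφ⟩
  refine ⟨u, h1, v, ?_, w, fun z hz => hφ z (List.mem_toFinset.2 hz)⟩
  rw [Metric.mem_sphere, h2]; push_cast; rfl

lemma measureReal_crossFamily_le {P : Measure ((Fin d → ℤ) → ℝ)} (hP : IsGaussianFreeField d P)
    (g : Fin d → ℤ) (L : ℕ) (h : ℝ) :
    P.real (levelEvent (crossFamily g L) h) ≤ crossProb P h L := by
  have := hP.isProbabilityMeasure
  calc _ ≤ _ := measureReal_mono (levelEvent_crossFamily_subset g L h)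
    _ = _ := hP.measureReal_levelEvent_translate g _ h
    _ ≤ _ := measureReal_mono (levelEvent_crossFamily_zero_subset L h)

lemma crossProb_nonneg (P : Measure ((Fin d → ℤ) → ℝ)) (h : ℝ) (L : ℕ) : 0 ≤ crossProb P h L :=
  measureReal_nonneg

lemma crossProb_anti {P : Measure ((Fin d → ℤ) → ℝ)} (hP : IsGaussianFreeField d P) {h h' : ℝ}
    (hh : h ≤ h') (L : ℕ) : crossProb P h' L ≤ crossProb P h L := by
  have := hP.isProbabilityMeasure
  refine measureReal_mono ?_
  rintro φ ⟨x, hx, y, hy, w, hw⟩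
  exact ⟨x, hx, y, hy, w, fun z hz => hh.trans (hw z hz)⟩

/-- Every lattice point is close to a point of the coarse lattice `L ℤ^d`. -/
lemma exists_coarse (L : ℕ) (hL : 0 < L) (m : ℕ) {z : Fin d → ℤ} (hz : dist z 0 ≤ (m * L : ℕ)) :
    ∃ k ∈ Finset.Icc (fun _ : Fin d => -(m : ℤ)) (fun _ => (m : ℤ)), dist z ((L : ℤ) • k) ≤ L := by
  rw [dist_le_natCast_iff] at hz
  have hL' : (0 : ℤ) < L := by exact_mod_cast hL
  refine ⟨fun i => z i / L, ?_, ?_⟩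
  · rw [Finset.mem_Icc]
    constructor <;> intro i
    · have := abs_le.1 (hz i)
      rw [Int.le_ediv_iff_mul_le hL']
      push_cast at this
      simp at this
      linarith
    · have := abs_le.1 (hz i)
      refine Int.ediv_le_of_le_mul hL' ?_
      push_cast at this
      simp at this
      linarith
  · rw [dist_le_natCast_iff]
    intro i
    have h1 := Int.mul_ediv_add_emod (z i) L
    have h2 := Int.emod_nonneg (z i) hL'.ne'
    have h3 := Int.emod_lt_of_pos (z i) hL'
    simp only [Pi.smul_apply, smul_eq_mul]
    rw [abs_le]
    constructor <;> linarith

lemma card_Icc_coarse (m : ℕ) :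
    (Finset.Icc (fun _ : Fin d => -(m : ℤ)) (fun _ => (m : ℤ))).card = (2 * m + 1) ^ d := by
  rw [Pi.card_Icc]
  simp only [Int.card_Icc, Finset.prod_const, Finset.card_univ, Fintype.card_fin]
  congr 1
  omega

/-- A crossing at scale `L'` yields two far apart crossings at scale `L`. -/
lemma connects_subset_iUnion {L L' m : ℕ} (hL : 0 < L) (h3 : 3 * L ≤ L') (hm : 2 * L' ≤ m * L)
    (h : ℝ) :
    connects (d := d) h (Metric.closedBall 0 (L' : ℝ)) (Metric.sphere 0 (2 * L' : ℝ)) ⊆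
      ⋃ p ∈ ((Finset.Icc (fun _ : Fin d => -(m : ℤ)) (fun _ => (m : ℤ)) ×ˢ
        Finset.Icc (fun _ : Fin d => -(m : ℤ)) (fun _ => (m : ℤ))).filter fun p =>
          (L' : ℝ) - 2 * L ≤ dist ((L : ℤ) • p.1) ((L : ℤ) • p.2)),
        levelEvent (crossFamily ((L : ℤ) • p.1) L) h ∩
          levelEvent (crossFamily ((L : ℤ) • p.2) L) h := by
  rintro φ ⟨u, hu, v, hv, w, hw⟩
  rw [Metric.mem_closedBall] at hu
  rw [Metric.mem_sphere] at hv
  have h3' : (3 * L : ℝ) ≤ L' := by exact_mod_cast h3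
  have hm' : (2 * L' : ℝ) ≤ m * L := by exact_mod_cast hm
  have hL0 : (0 : ℝ) ≤ L := Nat.cast_nonneg L
  -- The walk has a vertex `z₁` on `S(0, L')` and ends on `S(0, 2 L')`, so these two points are at
  -- least `L'` apart; rounding each to the coarse lattice loses at most `L`.
  obtain ⟨z₁, w', hz₁, hw'⟩ := exists_walk_to_sphere 0 L' w hu
    (by rw [hv]; linarith)
  have hz₁w : z₁ ∈ w.support := (hw' z₁ w'.end_mem_support).2
  obtain ⟨k₁, hk₁, hd₁⟩ := exists_coarse L hL m (z := z₁) (by rw [hz₁]; push_cast; linarith)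
  obtain ⟨k₂, hk₂, hd₂⟩ := exists_coarse L hL m (z := v) (by rw [hv]; push_cast; linarith)
  have t1 : (L' : ℝ) ≤ dist z₁ v := by
    have := dist_triangle_left v 0 z₁
    linarith
  have t2 := dist_triangle z₁ v ((L : ℤ) • k₁)
  have t3 := dist_triangle_right z₁ v ((L : ℤ) • k₁)
  have t4 := dist_triangle_right z₁ v ((L : ℤ) • k₂)
  have t5 := dist_triangle_right z₁ ((L : ℤ) • k₂) ((L : ℤ) • k₁)
  rw [dist_comm ((L : ℤ) • k₂)] at t5
  simp only [Set.mem_iUnion]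
  refine ⟨(k₁, k₂), ?_, ?_, ?_⟩
  · simp only [Finset.mem_filter, Finset.mem_product]
    exact ⟨⟨hk₁, hk₂⟩, by linarith⟩
  -- Each of the two points leaves the annulus around the other: its distance to the other's coarse
  -- point is at least `L' - L ≥ 2 L`.
  · exact mem_levelEvent_crossFamily w hw hz₁w w.end_mem_support hd₁ (by linarith)
  · exact mem_levelEvent_crossFamily w hw w.end_mem_support hz₁w hd₂ (by linarith)

/-- A union bound that keeps only one of the two crossings; it interpolates between consecutive
scales. -/
lemma crossProb_le_of_le {P : Measure ((Fin d → ℤ) → ℝ)} (hP : IsGaussianFreeField d P)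
    {L L' m : ℕ} (hL : 0 < L) (h3 : 3 * L ≤ L') (hm : 2 * L' ≤ m * L) (h : ℝ) :
    crossProb P h L' ≤ ((2 * m + 1) ^ d * (2 * m + 1) ^ d : ℕ) * crossProb P h L := by
  have := hP.isProbabilityMeasure
  calc crossProb P h L' ≤ _ := measureReal_mono (connects_subset_iUnion hL h3 hm h)
        (measure_ne_top _ _)
    _ ≤ _ := measureReal_biUnion_finset_le _ _
    _ ≤ _ := Finset.sum_le_card_nsmul _ _ (crossProb P h L) fun p _ =>
        (measureReal_mono Set.inter_subset_left).trans (measureReal_crossFamily_le hP _ L h)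
    _ ≤ _ := by
        rw [nsmul_eq_mul]
        refine mul_le_mul_of_nonneg_right ?_ (crossProb_nonneg P h L)
        rw [Nat.cast_le]
        refine (Finset.card_filter_le _ _).trans ?_
        rw [Finset.card_product, card_Icc_coarse]

/-! ### Renormalization across scales -/

/-- The ball `B(g, r)` as a finite set. -/
def finsetBall (g : Fin d → ℤ) (r : ℕ) : Finset (Fin d → ℤ) :=
  Finset.Icc (fun i => g i - r) (fun i => g i + r)

lemma mem_finsetBall {g z : Fin d → ℤ} {r : ℕ} : z ∈ finsetBall g r ↔ dist z g ≤ r := by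
  rw [finsetBall, Finset.mem_Icc, dist_le_natCast_iff, Pi.le_def, Pi.le_def, ← forall_and]
  refine forall_congr' fun i => ?_
  rw [abs_le]
  constructor <;> rintro ⟨h1, h2⟩ <;> constructor <;> linarith

lemma card_finsetBall (g : Fin d → ℤ) (r : ℕ) : (finsetBall g r).card = (2 * r + 1) ^ d := by
  rw [finsetBall, Pi.card_Icc]
  have : ∀ i, (g i + r + 1 - (g i - r)).toNat = 2 * r + 1 := fun i => by omega
  simp [this]

/-- One step of the renormalization scheme. -/
lemma crossProb_step {P : Measure ((Fin d → ℤ) → ℝ)} (hP : IsGaussianFreeField d P) (hd : 3 ≤ d)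
    {L L' m : ℕ} (hL : 0 < L) (h8 : 8 * L ≤ L') (hm : 2 * L' ≤ m * L) (h : ℝ) {δ : ℝ} (hδ : 0 ≤ δ)
    {v : ℝ} (hv : ∀ x : Fin d → ℤ, green x x - greenLow L x x ≤ v) :
    crossProb P h L' ≤ ((2 * m + 1) ^ d * (2 * m + 1) ^ d : ℕ) *
      (crossProb P (h - δ) L ^ 2 +
        4 * (4 * L + 1 : ℝ) ^ d * Real.exp (-(δ / 2) ^ 2 / (2 * v))) := by
  have := hP.isProbabilityMeasure
  have h8' : (8 * L : ℝ) ≤ L' := by exact_mod_cast h8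
  calc crossProb P h L' ≤ _ := measureReal_mono (connects_subset_iUnion hL (by omega) hm h)
        (measure_ne_top _ _)
    _ ≤ _ := measureReal_biUnion_finset_le _ _
    _ ≤ _ := Finset.sum_le_card_nsmul _ _ (crossProb P (h - δ) L ^ 2 +
        4 * (4 * L + 1 : ℝ) ^ d * Real.exp (-(δ / 2) ^ 2 / (2 * v))) fun p hp => by
        have hp' := (Finset.mem_filter.1 hp).2
        have key := hP.measureReal_inter_levelEvent_le hd hL
          (K₁ := finsetBall ((L : ℤ) • p.1) (2 * L)) (K₂ := finsetBall ((L : ℤ) • p.2) (2 * L))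
          (𝒮₁ := crossFamily ((L : ℤ) • p.1) L) (𝒮₂ := crossFamily ((L : ℤ) • p.2) L)
          -- The centres are at least `L' - 2 L ≥ 6 L` apart, and removing the two radii `2 L`
          -- leaves the separation `2 L` required with `N = L`.
          (fun x hx y hy => by
            rw [mem_finsetBall] at hx hy
            push_cast at hx hy
            have t1 := dist_triangle4 ((L : ℤ) • p.1) y x ((L : ℤ) • p.2)
            rw [dist_comm y x, dist_comm _ y] at t1
            linarith)
          (by
            rintro S ⟨u, v, w, -, -, h3, rfl⟩ z hz
            exact mem_finsetBall.2 (h3 z (List.mem_toFinset.1 hz)))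
          (by
            rintro S ⟨u, v, w, -, -, h3, rfl⟩ z hz
            exact mem_finsetBall.2 (h3 z (List.mem_toFinset.1 hz)))
          hv h hδ
        rw [card_finsetBall] at key
        push_cast at key
        -- The first factor is also lowered to level `h - δ`, so that the product becomes a square.
        have q1 := (measureReal_crossFamily_le hP ((L : ℤ) • p.1) L h).trans
          (crossProb_anti hP (by linarith : h - δ ≤ h) L)
        have q2 := measureReal_crossFamily_le hP ((L : ℤ) • p.2) L (h - δ)
        have q3 := mul_le_mul q1 q2 measureReal_nonneg (crossProb_nonneg P (h - δ) L)
        rw [show 2 * (2 * (L : ℝ)) + 1 = 4 * L + 1 by ring] at key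
        nlinarith
    _ ≤ _ := by
        rw [nsmul_eq_mul]
        refine mul_le_mul_of_nonneg_right ?_ (by positivity)
        rw [Nat.cast_le]
        refine (Finset.card_filter_le _ _).trans ?_
        rw [Finset.card_product, card_Icc_coarse]

/-- Polynomials are dominated by stretched exponentials. -/
lemma eventually_mul_pow_le_exp_rpow (B : ℝ) (k : ℕ) {κ : ℝ} (hκ : 0 < κ) :
    ∀ᶠ L : ℕ in atTop, B * (L : ℝ) ^ k ≤ Real.exp (κ * (L : ℝ) ^ (1 / 4 : ℝ)) := by
  have h1 : Tendsto (fun L : ℕ => (L : ℝ) ^ (1 / 4 : ℝ)) atTop atTop :=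
    (tendsto_rpow_atTop (by norm_num)).comp tendsto_natCast_atTop_atTop
  have h2 := (isLittleO_pow_exp_pos_mul_atTop (4 * k) hκ).comp_tendsto h1
  have h3 := h2.bound (c := (|B| + 1)⁻¹) (by positivity)
  filter_upwards [h3] with L hL
  have e : ((L : ℝ) ^ (1 / 4 : ℝ)) ^ (4 * k) = (L : ℝ) ^ k := by
    rw [pow_mul, ← Real.rpow_natCast ((L : ℝ) ^ (1 / 4 : ℝ)) 4, ← Real.rpow_mul (Nat.cast_nonneg L)]
    norm_num
  simp only [Function.comp_apply, e, Real.norm_eq_abs, Real.abs_exp] at hL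
  rw [abs_of_nonneg (by positivity : (0 : ℝ) ≤ (L : ℝ) ^ k), inv_mul_eq_div,
    le_div_iff₀ (by positivity)] at hL
  have : B ≤ |B| + 1 := by linarith [le_abs_self B]
  nlinarith [pow_nonneg (Nat.cast_nonneg (α := ℝ) L) k]

lemma rpow_quarter_scale (L : ℝ) (hL : 0 ≤ L) (n : ℕ) :
    (L * 4096 ^ n) ^ (1 / 4 : ℝ) = L ^ (1 / 4 : ℝ) * 8 ^ n := by
  rw [Real.mul_rpow hL (by positivity), show (4096 : ℝ) = 8 ^ 4 by norm_num, ← pow_mul, mul_comm 4 n,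
    pow_mul, ← Real.rpow_natCast (_ ^ n) 4, ← Real.rpow_mul (by positivity)]
  norm_num

/-- If the crossing probability is small at one sufficiently large scale, then it decays along a
geometric sequence of scales, at the price of a small increase of the level. -/
lemma exists_scale_decay {P : Measure ((Fin d → ℤ) → ℝ)} (hP : IsGaussianFreeField d P)
    (hd : 3 ≤ d) {ε : ℝ} (hε : 0 < ε) :
    ∃ η : ℝ, 0 < η ∧ ∃ L₁ : ℕ, 0 < L₁ ∧ ∀ L₀ : ℕ, L₁ ≤ L₀ → ∀ h₀ : ℝ, crossProb P h₀ L₀ ≤ η →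
      ∀ n : ℕ, crossProb P (h₀ + ε) (L₀ * 4096 ^ n) ≤ Real.exp (-2 ^ n) := by
  obtain ⟨C, hC, hgreen⟩ := exists_green_sub_greenLow_le hd
  -- Number of pairs of coarse points for `m = 8192 = 2 * 4096`.
  obtain ⟨A, hA⟩ : ∃ A : ℕ, A = (2 * 8192 + 1) ^ d * (2 * 8192 + 1) ^ d := ⟨_, rfl⟩
  have hA1 : (1 : ℝ) ≤ A := by
    have : 1 ≤ A := by rw [hA]; exact Nat.one_le_iff_ne_zero.2 (by positivity)
    exact_mod_cast this
  set κ := ε ^ 2 / (32 * C) with hκ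
  have hκ0 : 0 < κ := by positivity
  -- In `exp (9 d + 2)`, the `9 d` absorbs the growth of `L ^ d`, as `4096 ≤ exp 9`, and the `2`
  -- yields the target `exp (-2 ^ (n + 1))`. The choice does not involve the level.
  obtain ⟨L₁, hL₁⟩ := eventually_atTop.1
    (eventually_mul_pow_le_exp_rpow (16 * A ^ 2 * 5 ^ d * Real.exp (9 * d + 2)) d hκ0)
  refine ⟨Real.exp (-1) / (2 * A), by positivity, L₁ + 1, by omega, fun L₀ hL₀ h₀ hq => ?_⟩
  have hL₀1 : (1 : ℝ) ≤ L₀ := by exact_mod_cast (by omega : 1 ≤ L₀)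
  have hT := hL₁ L₀ (by omega)
  -- The level increments `ε 2 ^ (-(n + 1))` sum to `ε`. The factor `2 A` normalizes the recursion
  -- to half a square plus an error.
  have main : ∀ n : ℕ, 2 * A * crossProb P (h₀ + ε * (1 - (1 / 2) ^ n)) (L₀ * 4096 ^ n) ≤
      Real.exp (-2 ^ n) := by
    intro n
    induction n with
    | zero =>
      simp only [pow_zero, sub_self, mul_zero, add_zero, mul_one]
      rw [le_div_iff₀ (by positivity)] at hq
      linarith
    | succ n ih =>
      set L := L₀ * 4096 ^ n with hLdef
      have hLpos : 0 < L := by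
        rw [hLdef]; exact Nat.mul_pos (by omega) (by positivity)
      have hLc : (L : ℝ) = L₀ * 4096 ^ n := by rw [hLdef]; push_cast; ring
      have hLnext : L₀ * 4096 ^ (n + 1) = L * 4096 := by rw [hLdef]; ring
      set δ := ε * (1 / 2) ^ (n + 1) with hδ
      have hstep := crossProb_step hP hd hLpos (L' := L₀ * 4096 ^ (n + 1)) (m := 8192)
        (by rw [hLnext]; omega) (by rw [hLnext]; omega)
        (h₀ + ε * (1 - (1 / 2) ^ (n + 1))) (δ := δ) (by positivity)
        (v := C * (L : ℝ) ^ (-(1 / 4) : ℝ)) (fun x => hgreen L x x hLpos)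
      have hlev : h₀ + ε * (1 - (1 / 2) ^ (n + 1)) - δ = h₀ + ε * (1 - (1 / 2) ^ n) := by
        rw [hδ, pow_succ]; ring
      rw [hlev, ← hA] at hstep
      set q := crossProb P (h₀ + ε * (1 - (1 / 2) ^ n)) L with hqdef
      have hq0 : 0 ≤ q := crossProb_nonneg _ _ _
      -- `δ ^ 2` shrinks like `4 ^ (-n)` while the inverse variance grows like `L ^ (1/4)`, that is
      -- `8 ^ n` since `4096 = 8 ^ 4`. The net growth `2 ^ n` matches the target exponent.
      have hexp : -(δ / 2) ^ 2 / (2 * (C * (L : ℝ) ^ (-(1 / 4) : ℝ))) =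
          -(κ * (L₀ : ℝ) ^ (1 / 4 : ℝ) * 2 ^ n) := by
        rw [Real.rpow_neg (Nat.cast_nonneg L), hLc, rpow_quarter_scale _ (by linarith),
          hδ, hκ, pow_succ (1 / 2 : ℝ)]
        have h8 : (8 : ℝ) ^ n = 2 ^ n * 2 ^ n * 2 ^ n := by
          rw [← mul_pow, ← mul_pow]; norm_num
        have h2 : ((1 : ℝ) / 2) ^ n = (2 ^ n)⁻¹ := by rw [one_div, inv_pow]
        rw [h8, h2]
        field_simp
        ring
      rw [hexp] at hstep
      have h2n : (n : ℝ) ≤ 2 ^ n := by exact_mod_cast (Nat.lt_two_pow_self (n := n)).le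
      have h12n : (1 : ℝ) ≤ 2 ^ n := one_le_pow₀ (by norm_num)
      have hpoly : (4 * L + 1 : ℝ) ^ d ≤ 5 ^ d * (L₀ : ℝ) ^ d * Real.exp (9 * d * 2 ^ n) := by
        have h4096 : (4096 : ℝ) ≤ Real.exp 9 := by
          have h22 : (2.7 : ℝ) ≤ Real.exp 1 := by linarith [Real.exp_one_gt_d9]
          calc (4096 : ℝ) ≤ 2.7 ^ 9 := by norm_num
            _ ≤ Real.exp 1 ^ 9 := by gcongr
            _ = Real.exp 9 := by rw [← Real.exp_nat_mul]; norm_num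
        have h1L : (1 : ℝ) ≤ L := by exact_mod_cast hLpos
        calc (4 * L + 1 : ℝ) ^ d ≤ (5 * (L₀ * Real.exp 9 ^ n)) ^ d := by
              refine pow_le_pow_left₀ (by positivity) ?_ d
              have : (L : ℝ) ≤ L₀ * Real.exp 9 ^ n := by rw [hLc]; gcongr
              linarith
          _ = 5 ^ d * (L₀ : ℝ) ^ d * Real.exp (9 * d * n) := by
              rw [mul_pow, mul_pow, ← pow_mul, ← Real.exp_nat_mul, mul_assoc]
              congr 3; push_cast; ring
          _ ≤ _ := by gcongr
      have herr : 2 * (A : ℝ) ^ 2 * (4 * (4 * L + 1 : ℝ) ^ d *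
          Real.exp (-(κ * (L₀ : ℝ) ^ (1 / 4 : ℝ) * 2 ^ n))) ≤ 1 / 2 * Real.exp (-2 ^ (n + 1)) := by
        set M := κ * (L₀ : ℝ) ^ (1 / 4 : ℝ) with hM
        have hB : 16 * (A : ℝ) ^ 2 * 5 ^ d * (L₀ : ℝ) ^ d ≤ Real.exp (M - (9 * d + 2)) := by
          rw [Real.exp_sub, le_div_iff₀ (Real.exp_pos _)]
          linarith
        have hB1 : (1 : ℝ) ≤ Real.exp (M - (9 * d + 2)) := by
          refine le_trans ?_ hB
          have a1 : (1 : ℝ) ≤ (A : ℝ) ^ 2 := one_le_pow₀ hA1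
          have a2 : (1 : ℝ) ≤ (5 : ℝ) ^ d := one_le_pow₀ (by norm_num)
          have a3 : (1 : ℝ) ≤ (L₀ : ℝ) ^ d := one_le_pow₀ hL₀1
          have a4 : (1 : ℝ) ≤ 16 * (A : ℝ) ^ 2 := by linarith
          exact one_le_mul_of_one_le_of_one_le (one_le_mul_of_one_le_of_one_le a4 a2) a3
        have hM0 : 0 ≤ M - (9 * d + 2) := Real.one_le_exp_iff.1 hB1
        calc 2 * (A : ℝ) ^ 2 * (4 * (4 * L + 1 : ℝ) ^ d * Real.exp (-(M * 2 ^ n)))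
            ≤ 2 * (A : ℝ) ^ 2 * (4 * (5 ^ d * (L₀ : ℝ) ^ d * Real.exp (9 * d * 2 ^ n)) *
                Real.exp (-(M * 2 ^ n))) := by gcongr
          _ = 1 / 2 * (16 * (A : ℝ) ^ 2 * 5 ^ d * (L₀ : ℝ) ^ d) *
                (Real.exp (9 * d * 2 ^ n) * Real.exp (-(M * 2 ^ n))) := by ring
          _ ≤ 1 / 2 * Real.exp ((M - (9 * d + 2)) * 2 ^ n) *
                (Real.exp (9 * d * 2 ^ n) * Real.exp (-(M * 2 ^ n))) := by
              gcongr
              refine hB.trans (Real.exp_le_exp.2 ?_)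
              exact le_mul_of_one_le_right hM0 h12n
          _ = 1 / 2 * Real.exp (-2 ^ (n + 1)) := by
              rw [mul_assoc, ← Real.exp_add, ← Real.exp_add]
              congr 2
              ring
      have hsq : (2 * A * q) ^ 2 ≤ Real.exp (-2 ^ (n + 1)) := by
        calc (2 * A * q) ^ 2 ≤ Real.exp (-2 ^ n) ^ 2 := by gcongr
          _ = _ := by rw [← Real.exp_nat_mul]; congr 1; push_cast; ring
      -- The bound becomes `(2 A q) ^ 2 / 2` plus `2 A ^ 2` times the error, each at most half of
      -- `exp (-2 ^ (n + 1))`.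
      have hstep' := mul_le_mul_of_nonneg_left hstep (by positivity : (0 : ℝ) ≤ 2 * A)
      nlinarith
  intro n
  have hlev : h₀ + ε * (1 - (1 / 2) ^ n) ≤ h₀ + ε := by
    have : (0 : ℝ) ≤ (1 / 2) ^ n := by positivity
    nlinarith
  have h1 := crossProb_anti hP hlev (L₀ * 4096 ^ n)
  have h2 := main n
  have h3 := crossProb_nonneg P (h₀ + ε * (1 - (1 / 2) ^ n)) (L₀ * 4096 ^ n)
  nlinarith

/-! ### From geometric scales to all scales, and the critical level -/

/-- Stretched exponential decay along a geometric sequence of scales extends to all scales. -/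
lemma exists_decay_of_scale_decay {P : Measure ((Fin d → ℤ) → ℝ)} (hP : IsGaussianFreeField d P)
    {h : ℝ} {L₀ : ℕ} (hL₀ : 0 < L₀)
    (hdec : ∀ n : ℕ, crossProb P h (L₀ * 4096 ^ n) ≤ Real.exp (-2 ^ n)) :
    ∃ c c' : ℝ, Real.exp 1 ≤ c ∧ 0 < c' ∧ c' ≤ 1 ∧
      ∀ L : ℕ, 1 ≤ L → crossProb P h L ≤ c * Real.exp (-c' * (L : ℝ) ^ (1 / 12 : ℝ)) := by
  have := hP.isProbabilityMeasure
  -- Here `m = 24576 = 2 * 3 * 4096`, since `L` is below `3 * 4096` times the preceding scale.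
  obtain ⟨B, hB⟩ : ∃ B : ℕ, B = (2 * 24576 + 1) ^ d * (2 * 24576 + 1) ^ d := ⟨_, rfl⟩
  have hL₀' : (1 : ℝ) ≤ L₀ := by exact_mod_cast hL₀
  set R : ℝ := 3 * L₀ * 4096 with hR
  have hR1 : 1 ≤ R := by rw [hR]; linarith
  have hR0 : 0 < R := by linarith
  have hscale : ∀ L : ℝ, 0 ≤ L → (R ^ (1 / 12 : ℝ))⁻¹ * L ^ (1 / 12 : ℝ) = (L / R) ^ (1 / 12 : ℝ) := by
    intro L hL
    rw [Real.div_rpow hL hR0.le, inv_mul_eq_div]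
  -- The conditions `exp 1 ≤ c` and `c' ≤ 1` later make the point-to-point bound trivial near the
  -- origin with the same `c`.
  refine ⟨B + Real.exp 1, (R ^ (1 / 12 : ℝ))⁻¹, by linarith [Nat.cast_nonneg (α := ℝ) B],
    by positivity, inv_le_one_of_one_le₀ (Real.one_le_rpow hR1 (by norm_num)), fun L hL => ?_⟩
  rw [neg_mul, hscale L (Nat.cast_nonneg L)]
  rcases Nat.lt_or_ge L (3 * L₀) with hlt | hge
  · have h1 : crossProb P h L ≤ 1 := measureReal_le_one
    have h2 : ((L : ℝ) / R) ^ (1 / 12 : ℝ) ≤ 1 := by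
      refine Real.rpow_le_one (by positivity) ?_ (by norm_num)
      rw [div_le_one hR0]
      have : (L : ℝ) ≤ 3 * L₀ := by exact_mod_cast hlt.le
      rw [hR]; linarith
    calc crossProb P h L ≤ Real.exp 1 * Real.exp (-((L : ℝ) / R) ^ (1 / 12 : ℝ)) := by
          rw [← Real.exp_add]
          exact h1.trans (Real.one_le_exp (by linarith))
      _ ≤ _ := by
          gcongr
          linarith [Nat.cast_nonneg (α := ℝ) B]
  · obtain ⟨n, hn1, hn2⟩ := exists_nat_pow_near (x := (L : ℝ) / (3 * L₀)) (y := 4096)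
      (by
        rw [le_div_iff₀ (by positivity), one_mul]
        exact_mod_cast hge) (by norm_num)
    rw [le_div_iff₀ (by positivity)] at hn1
    rw [div_lt_iff₀ (by positivity)] at hn2
    have e1 : 3 * (L₀ * 4096 ^ n) ≤ L := by
      have : ((3 * (L₀ * 4096 ^ n) : ℕ) : ℝ) ≤ L := by push_cast; linarith
      exact_mod_cast this
    have e2 : 2 * L ≤ 24576 * (L₀ * 4096 ^ n) := by
      have : ((2 * L : ℕ) : ℝ) ≤ ((24576 * (L₀ * 4096 ^ n) : ℕ) : ℝ) := by
        push_cast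
        rw [pow_succ] at hn2
        linarith
      exact_mod_cast this
    have h1 := crossProb_le_of_le hP (Nat.mul_pos hL₀ (by positivity)) e1 e2 h
    rw [← hB] at h1
    -- Since `L / R < 4096 ^ n` and `4096 = 2 ^ 12`, the exponent is `ρ = 1/12`.
    have h2 : ((L : ℝ) / R) ^ (1 / 12 : ℝ) ≤ 2 ^ n := by
      calc ((L : ℝ) / R) ^ (1 / 12 : ℝ) ≤ ((2 ^ n : ℝ) ^ (12 : ℕ)) ^ (1 / 12 : ℝ) := by
            refine Real.rpow_le_rpow (by positivity) ?_ (by norm_num)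
            rw [div_le_iff₀ hR0, ← pow_mul, mul_comm n, pow_mul, hR]
            norm_num
            rw [pow_succ] at hn2
            linarith
        _ = 2 ^ n := by
            rw [← Real.rpow_natCast (2 ^ n : ℝ) 12, ← Real.rpow_mul (by positivity)]
            norm_num
    calc crossProb P h L ≤ B * Real.exp (-2 ^ n) :=
          h1.trans (mul_le_mul_of_nonneg_left (hdec n) (Nat.cast_nonneg B))
      _ ≤ (B + Real.exp 1) * Real.exp (-((L : ℝ) / R) ^ (1 / 12 : ℝ)) := by
          gcongr
          linarith [Real.exp_pos 1]

/-- At a fixed scale the crossing probability is small at high levels. -/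
lemma exists_crossProb_le {P : Measure ((Fin d → ℤ) → ℝ)} (hP : IsGaussianFreeField d P)
    (L : ℕ) {η : ℝ} (hη : 0 < η) : ∃ h : ℝ, crossProb P h L ≤ η := by
  have := hP.isProbabilityMeasure
  set v := green (0 : Fin d → ℤ) 0 with hv
  have hgv : ∀ x : Fin d → ℤ, green x x = v := fun x => by
    simpa using green_add_right (0 : Fin d → ℤ) 0 x
  have hv0 : 0 ≤ v := tsum_nonneg fun n => walkProb_nonneg n _ _
  -- A crossing needs a vertex of `B(0, L)` above `h`. The variance proxy `v + 1` avoids having to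
  -- show `v > 0`.
  have hbound : ∀ h : ℝ, 0 ≤ h → crossProb P h L ≤
      (finsetBall (0 : Fin d → ℤ) L).card * Real.exp (-h ^ 2 / (2 * (v + 1))) := by
    intro h hh
    have hsub : connects h (Metric.closedBall 0 (L : ℝ)) (Metric.sphere 0 (2 * L : ℝ)) ⊆
        ⋃ x ∈ finsetBall (0 : Fin d → ℤ) L, {φ : (Fin d → ℤ) → ℝ | h ≤ φ x} := by
      rintro φ ⟨x, hx, y, -, w, hw⟩
      simp only [Set.mem_iUnion]
      exact ⟨x, mem_finsetBall.2 hx, hw x w.start_mem_support⟩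
    calc crossProb P h L ≤ _ := measureReal_mono hsub (measure_ne_top _ _)
      _ ≤ _ := measureReal_biUnion_finset_le _ _
      _ ≤ _ := Finset.sum_le_card_nsmul _ _ (Real.exp (-h ^ 2 / (2 * (v + 1)))) fun x _ => by
          refine measureReal_ge_le_of_hasGaussianLaw (hP.gaussian.hasGaussianLaw_eval x)
            (hP.centered x) ?_ hh
          simp_rw [sq]
          rw [hP.covariance, hgv]
          linarith
      _ = _ := nsmul_eq_mul _ _
  have hlim : Tendsto (fun h : ℝ => (finsetBall (0 : Fin d → ℤ) L).card *
      Real.exp (-h ^ 2 / (2 * (v + 1)))) atTop (𝓝 0) := by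
    rw [← mul_zero ((finsetBall (0 : Fin d → ℤ) L).card : ℝ)]
    refine Tendsto.const_mul _ (Real.tendsto_exp_atBot.comp ?_)
    exact (tendsto_neg_atTop_atBot.comp (tendsto_pow_atTop two_ne_zero)).atBot_div_const
      (by positivity)
  obtain ⟨h, hh, hh0⟩ := ((hlim.eventually_le_const hη).and (eventually_ge_atTop 0)).exists
  exact ⟨h, (hbound h hh0).trans hh⟩

lemma tendsto_mul_crossProb_of_decay {P : Measure ((Fin d → ℤ) → ℝ)} {h c c' : ℝ} (hc' : 0 < c')
    (hdec : ∀ L : ℕ, 1 ≤ L → crossProb P h L ≤ c * Real.exp (-c' * (L : ℝ) ^ (1 / 12 : ℝ))) :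
    Tendsto (fun L : ℕ => (L : ℝ) ^ (1 : ℝ) * crossProb P h L) atTop (𝓝 0) := by
  have h1 : Tendsto (fun L : ℕ => (L : ℝ) ^ (1 / 12 : ℝ)) atTop atTop :=
    (tendsto_rpow_atTop (by norm_num)).comp tendsto_natCast_atTop_atTop
  have h2 := ((tendsto_rpow_mul_exp_neg_mul_atTop_nhds_zero 12 c' hc').comp h1).const_mul c
  rw [mul_zero] at h2
  refine squeeze_zero' (Eventually.of_forall fun L => ?_) ?_ h2
  · exact mul_nonneg (by positivity) (crossProb_nonneg P h L)
  · filter_upwards [eventually_ge_atTop 1] with L hL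
    have e : ((L : ℝ) ^ (1 / 12 : ℝ)) ^ (12 : ℝ) = L := by
      rw [← Real.rpow_mul (Nat.cast_nonneg L)]; norm_num
    simp only [Function.comp_apply, e, Real.rpow_one]
    calc (L : ℝ) * crossProb P h L ≤ L * (c * Real.exp (-c' * (L : ℝ) ^ (1 / 12 : ℝ))) :=
          mul_le_mul_of_nonneg_left (hdec L hL) (Nat.cast_nonneg L)
      _ = _ := by ring

/-- The thresholds `η` and `L₁` are uniform in the level, so the scale can be fixed first and the
level raised afterwards. -/
lemma hStarStar_lt_top {P : Measure ((Fin d → ℤ) → ℝ)} (hP : IsGaussianFreeField d P)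
    (hd : 3 ≤ d) : hStarStar P < ⊤ := by
  obtain ⟨η, hη, L₁, hL₁, hdec⟩ := exists_scale_decay hP hd one_pos
  obtain ⟨h₀, hh₀⟩ := exists_crossProb_le hP L₁ hη
  obtain ⟨c, c', -, hc', -, hL⟩ := exists_decay_of_scale_decay hP hL₁ (hdec L₁ le_rfl h₀ hh₀)
  refine (sInf_le ?_).trans_lt (EReal.coe_lt_top (h₀ + 1))
  exact ⟨h₀ + 1, ⟨1, one_pos, tendsto_mul_crossProb_of_decay hc' hL⟩, rfl⟩

lemma tendsto_crossProb_of_tendsto_rpow_mul {P : Measure ((Fin d → ℤ) → ℝ)} {h α : ℝ} (hα : 0 < α)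
    (hlim : Tendsto (fun L : ℕ => (L : ℝ) ^ α * crossProb P h L) atTop (𝓝 0)) :
    Tendsto (fun L : ℕ => crossProb P h L) atTop (𝓝 0) := by
  refine squeeze_zero' (Eventually.of_forall fun L => crossProb_nonneg P h L) ?_ hlim
  filter_upwards [eventually_ge_atTop 1] with L hL
  refine le_mul_of_one_le_left (crossProb_nonneg P h L) (Real.one_le_rpow ?_ hα.le)
  exact_mod_cast hL

/-- Some `h₀ < h` has crossing probabilities tending to `0`; the gap `h - h₀` is the sprinkling
budget. The polynomial rate in the definition of `h_**` serves only to give this convergence. -/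
lemma exists_decay_of_hStarStar_lt {P : Measure ((Fin d → ℤ) → ℝ)} (hP : IsGaussianFreeField d P)
    (hd : 3 ≤ d) {h : ℝ} (hh : hStarStar P < (h : EReal)) :
    ∃ c c' : ℝ, Real.exp 1 ≤ c ∧ 0 < c' ∧ c' ≤ 1 ∧
      ∀ L : ℕ, 1 ≤ L → crossProb P h L ≤ c * Real.exp (-c' * (L : ℝ) ^ (1 / 12 : ℝ)) := by
  obtain ⟨_, ⟨h₀, ⟨α, hα, hlim⟩, rfl⟩, hlt⟩ := sInf_lt_iff.1 hh
  have hlt' : h₀ < h := EReal.coe_lt_coe_iff.1 hlt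
  obtain ⟨η, hη, L₁, hL₁, hdec⟩ := exists_scale_decay hP hd (sub_pos.2 hlt')
  obtain ⟨L₀, hq, hL₀⟩ := (((tendsto_crossProb_of_tendsto_rpow_mul hα hlim).eventually_le_const
    hη).and (eventually_ge_atTop L₁)).exists
  have := hdec L₀ hL₀ h₀ hq
  rw [add_sub_cancel] at this
  exact exists_decay_of_scale_decay hP (by omega) this

/-! ### Decay of the connectivity function -/

lemma euclNorm_le (x : Fin d → ℤ) : euclNorm x ≤ d * dist x 0 := by
  have hr : 0 ≤ dist x 0 := dist_nonneg
  rw [euclNorm, Real.sqrt_le_left (by positivity)]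
  calc ∑ i, (x i : ℝ) ^ 2 ≤ ∑ _i : Fin d, dist x 0 ^ 2 := by
        refine Finset.sum_le_sum fun i _ => ?_
        rw [← sq_abs]
        have := dist_le_pi_dist x 0 i
        rw [Int.dist_eq] at this
        gcongr
        simpa using this
    _ = d * dist x 0 ^ 2 := by simp
    _ ≤ (d * dist x 0) ^ 2 := by
        rw [mul_pow]
        refine mul_le_mul_of_nonneg_right ?_ (sq_nonneg _)
        exact_mod_cast Nat.le_self_pow two_ne_zero d

lemma connects_singleton_subset (h : ℝ) {x : Fin d → ℤ} {L : ℕ} (hL : (2 * L : ℝ) ≤ dist x 0) :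
    connects h {0} {x} ⊆
      connects h (Metric.closedBall 0 (L : ℝ)) (Metric.sphere 0 (2 * L : ℝ)) := by
  rintro φ ⟨u, rfl, v, rfl, w, hw⟩
  obtain ⟨v', w', h1, h2⟩ := exists_walk_to_sphere 0 (2 * L) w (by rw [dist_self]; positivity)
    (by push_cast; exact hL)
  refine ⟨0, by simp, v', ?_, w', fun z hz => hw z (h2 z hz).2⟩
  rw [Metric.mem_sphere, h1]; push_cast; rfl

lemma measureReal_connects_le_of_decay {P : Measure ((Fin d → ℤ) → ℝ)} [IsProbabilityMeasure P]
    (hd : 0 < d) {h c c' ρ : ℝ} (hc : Real.exp 1 ≤ c) (hc' : 0 < c') (hc'1 : c' ≤ 1) (hρ : 0 < ρ)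
    (hdec : ∀ L : ℕ, 1 ≤ L → crossProb P h L ≤ c * Real.exp (-c' * (L : ℝ) ^ ρ))
    (x : Fin d → ℤ) :
    P.real (connects h {0} {x}) ≤
      c * Real.exp (-(c' * ((4 * d : ℝ)⁻¹) ^ ρ) * euclNorm x ^ ρ) := by
  have hd' : (0 : ℝ) < d := by exact_mod_cast hd
  have hc0 : 0 < c := (Real.exp_pos 1).trans_le hc
  have hx0 : 0 ≤ euclNorm x := Real.sqrt_nonneg _
  have hx := euclNorm_le x
  have e : -(c' * ((4 * d : ℝ)⁻¹) ^ ρ) * euclNorm x ^ ρ =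
      -(c' * (euclNorm x / (4 * d)) ^ ρ) := by
    rw [div_eq_inv_mul, Real.mul_rpow (by positivity) hx0]; ring
  have hle : euclNorm x / (4 * d) ≤ dist x 0 / 4 := by
    rw [div_le_iff₀ (by positivity)]
    linarith
  rw [e]
  rcases lt_or_ge (dist x 0) 2 with hlt | hge
  · have h1 : (euclNorm x / (4 * d)) ^ ρ ≤ 1 :=
      Real.rpow_le_one (by positivity) (by linarith) hρ.le
    have h2 : c' * (euclNorm x / (4 * d)) ^ ρ ≤ 1 :=
      mul_le_one₀ hc'1 (by positivity) h1
    calc P.real (connects h {0} {x}) ≤ 1 := measureReal_le_one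
      _ ≤ Real.exp 1 * Real.exp (-(c' * (euclNorm x / (4 * d)) ^ ρ)) := by
          rw [← Real.exp_add]; exact Real.one_le_exp (by linarith)
      _ ≤ _ := by gcongr
  -- Take `L = ⌊dist x 0 / 2⌋`. As `L ≥ 1`, it is at least `dist x 0 / 4`, hence at least `euclNorm
  -- x / (4 d)`.
  · have hfl := Nat.floor_le (show 0 ≤ dist x 0 / 2 by linarith)
    have hlt := Nat.lt_floor_add_one (dist x 0 / 2)
    have hL1 : 1 ≤ ⌊dist x 0 / 2⌋₊ := Nat.le_floor (by push_cast; linarith)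
    have hL1' : (1 : ℝ) ≤ ⌊dist x 0 / 2⌋₊ := by exact_mod_cast hL1
    calc P.real (connects h {0} {x}) ≤ crossProb P h ⌊dist x 0 / 2⌋₊ :=
          measureReal_mono (connects_singleton_subset h (by linarith))
      _ ≤ _ := hdec _ hL1
      _ ≤ _ := by
          rw [neg_mul]
          gcongr
          linarith

end GFF

end

theorem theorem2p6 (d : ℕ) (hd : 3 ≤ d) (P : Measure ((Fin d → ℤ) → ℝ))
    (hP : GFF.IsGaussianFreeField d P) :
    GFF.hStarStar P < ⊤ ∧
    ∀ h : ℝ, GFF.hStarStar P < (h : EReal) →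
      ∃ c c' ρ : ℝ, 0 < c ∧ 0 < c' ∧ 0 < ρ ∧ ρ < 1 ∧
        (∀ L : ℕ, 1 ≤ L →
          P.real (GFF.connects h (Metric.closedBall 0 (L : ℝ)) (Metric.sphere 0 (2 * L : ℝ))) ≤
            c * Real.exp (-c' * (L : ℝ) ^ ρ)) ∧
        ∃ c'' : ℝ, 0 < c'' ∧ ∀ x : Fin d → ℤ,
          P.real (GFF.connects h {0} {x}) ≤ c * Real.exp (-c'' * GFF.euclNorm x ^ ρ) := by
  have := hP.isProbabilityMeasure
  refine ⟨GFF.hStarStar_lt_top hP hd, fun h hh => ?_⟩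
  obtain ⟨c, c', hc, hc', hc'1, hdec⟩ := GFF.exists_decay_of_hStarStar_lt hP hd hh
  have hd' : (0 : ℝ) < d := by exact_mod_cast (by omega : 0 < d)
  exact ⟨c, c', 1 / 12, (Real.exp_pos 1).trans_le hc, hc', by norm_num, by norm_num, hdec,
    c' * ((4 * d : ℝ)⁻¹) ^ (1 / 12 : ℝ), by positivity,
    GFF.measureReal_connects_le_of_decay (by omega) hc hc' hc'1 (by norm_num) hdec⟩
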